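/- **Domains.** Let $D$ be a partial order. A subset is *consistent* if it has an upper bound in $D$, and *pairwise consistent* if any two of its elements have an upper bound in $D$. An element $c$ is *compact* if whenever $c\sqsubseteq\bigsqcup X$ for a directed set $X$ having a least upper bound, $c\sqsubseteq x$ for some $x\in X$. $D$ is a *domain* if every pairwise consistent subset has a least upper bound, every $x\in D$ is the least upper bound of the compact elements below it, and $\{y\mid y\sqsubseteq c\}$ is finite for every compact $c$. An *irreducible* is a compact $i$ such that $i\in X$ whenever $i=\bigsqcup X$ with $X$ a pairwise consistent set of compact elements. Irreducibles $i,i'$ are *interchangeable*, $i\leftrightarrow i'$, if for every set $X$ of irreducibles such that $X\cup\{i\}$ and $X\cup\{i'\}$ are both downward closed among the irreducibles and consistent, $\bigsqcup(X\cup\{i\})=\bigsqcup(X\cup\{i'\})$, and for some such $X$ one has $\bigsqcup X\ne\bigsqcup(X\cup\{i\})$. A *weak prime* is an irreducible $i$ such that for every consistent $X\subseteq D$ with $i\sqsubseteq\bigsqcup X$ there are $d\in X$ and an irreducible $i'\leftrightarrow i$ with $i'\sqsubseteq d$. A *weak prime domain* is a domain in which every element is the least upper bound of the weak primes below it. **Weak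 asynchronous graphs.** A *weak asynchronous graph* $A$ consists of a directed graph (nodes $N$, edges $U$, source and target maps; parallel edges are allowed a priori), an origin $n_0\in N$, and an equivalence relation $\simeq$ on the set of paths of length $2$ that relates only paths with the same source and the same target. Call $u_1;u_2\simeq v_1;v_2$ a *square* if $u_1\neq v_1$. The axioms are: 1. if $u_1;u_2\simeq v_1;v_2$ and $u_2\ne v_2$, then $u_1\neq v_1$; 2. if $u;u_1\simeq v_1;v_2$ and $u;u_1'\simeq v_1';v_2'$ are squares, then $u_1=u_1'$ iff $v_1=v_1'$; 3. (forward cube axiom) if $u_1;u_2\simeq w;x$, $\;v_1;v_2\simeq w;y$ and $x;u_3\simeq y;v_3$ are squares, then there are edges $p,q,r$ such that $u_1;p\simeq v_1;q$, $\;u_2;u_3\simeq p;r$ and $v_2;v_3\simeq q;r$ are squares; 4. (coherence) if $u_1;u_2\simeq w;x$, $\;v_1;v_2\simeq w;y$ and $u_1;p\simeq v_1;q$ are squares, then there are edges $u_3,v_3,r$ such that $u_2;u_3\simeq p;r$ and $v_2;v_3\simeq q;r$ are squares. Extend $\simeq$ to all paths as the equivalence relation generated by $w_1;w;w_2\simeq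 w_1;w';w_2$ for $w\simeq w'$ of length $2$. $A$ is *weak prime* if any two paths from $n_0$ with the same target are equivalent. $P(A)$ is the set of equivalence classes of paths from $n_0$ (including the empty path), partially ordered by prefix: $c\le c'$ iff some path in $c$ is a prefix of some path in $c'$. The *ideal completion* $\mathrm{Idl}(P)$ of a partial order $P$ is the set of its ideals (non-empty, directed, downward closed subsets) ordered by inclusion. **Proposition.** For every weak prime asynchronous graph $A$ (a weak asynchronous graph that is weak prime), $\mathrm{Idl}(P(A))$ is a weak prime domain. Conversely, every weak prime domain $D$ is isomorphic, as a partial order, to $\mathrm{Idl}(P(A))$ for some weak prime asynchronous graph $A$. -/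

import Mathlib

/-! ### Domains and weak prime domains -/

namespace WeakPrimeDom

/-- `X` is pairwise consistent: any two of its elements have an upper bound. -/
def PairwiseConsistent {D : Type*} [PartialOrder D] (X : Set D) : Prop :=
  ∀ x ∈ X, ∀ y ∈ X, BddAbove ({x, y} : Set D)

/-- A domain: a coherent, algebraic and finitary partial order. -/
structure IsDomainOrder (D : Type*) [PartialOrder D] : Prop where
  /-- every pairwise consistent subset has a least upper bound -/
  coherent : ∀ X : Set D, PairwiseConsistent X → ∃ s, IsLUB X s
  /-- every element is the least upper bound of the compact elements below it -/
  algebraic : ∀ x : D, IsLUB {c | c ≤ x ∧ IsCompactElement c} x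
  /-- only finitely many elements lie below a compact element -/
  finitary : ∀ a : D, IsCompactElement a → (Set.Iic a).Finite

/-- Irreducibles: compact elements `i` such that `i = ⨆ X` with `X` a pairwise consistent set of
compact elements forces `i ∈ X`. -/
def IsIrreducible {D : Type*} [PartialOrder D] (i : D) : Prop :=
  IsCompactElement i ∧
    ∀ X : Set D, (∀ x ∈ X, IsCompactElement x) → PairwiseConsistent X → IsLUB X i → i ∈ X

/-- A set of irreducibles which is downward closed (among the irreducibles) and consistent. -/
def IsConsistentDownset {D : Type*} [PartialOrder D] (X : Set D) : Prop :=
  (∀ x ∈ X, IsIrreducible x) ∧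
    (∀ x ∈ X, ∀ j, IsIrreducible j → j ≤ x → j ∈ X) ∧ BddAbove X

/-- Interchangeability `i ↔ j` of two irreducibles: for all sets `X` of irreducibles such that
`X ∪ {i}` and `X ∪ {j}` are downward closed and consistent, `⨆ (X ∪ {i}) = ⨆ (X ∪ {j})`, and
`⨆ X ≠ ⨆ (X ∪ {i})` for some such `X`. -/
def Interchangeable {D : Type*} [PartialOrder D] (i j : D) : Prop :=
  IsIrreducible i ∧ IsIrreducible j ∧
    (∀ X : Set D, IsConsistentDownset (X ∪ {i}) → IsConsistentDownset (X ∪ {j}) →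
      ∃ s, IsLUB (X ∪ {i}) s ∧ IsLUB (X ∪ {j}) s) ∧
    ∃ X : Set D, IsConsistentDownset (X ∪ {i}) ∧ IsConsistentDownset (X ∪ {j}) ∧
      ∃ a b, IsLUB X a ∧ IsLUB (X ∪ {i}) b ∧ a ≠ b

/-- Weak primes: irreducibles `i` such that whenever `i ≤ ⨆ X` with `X` consistent, some
irreducible interchangeable with `i` lies below an element of `X`. -/
def IsWeakPrime {D : Type*} [PartialOrder D] (i : D) : Prop :=
  IsIrreducible i ∧
    ∀ (X : Set D) (s : D), BddAbove X → IsLUB X s → i ≤ s →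
      ∃ j, Interchangeable i j ∧ ∃ d ∈ X, j ≤ d

/-- A weak prime domain: a domain in which every element is the least upper bound of the weak
primes below it. -/
structure IsWeakPrimeDomain (D : Type*) [PartialOrder D] : Prop where
  isDomainOrder : IsDomainOrder D
  weakPrimeAlgebraic : ∀ d : D, IsLUB {p | p ≤ d ∧ IsWeakPrime p} d

end WeakPrimeDom

/-! ### Weak asynchronous graphs -/

/-- A directed graph with nodes `N`, edges `U`, source `s`, target `t`, an origin `n₀` and a
relation `sim` on pairs of edges. -/
structure PointedSquareGraph (N : Type*) (U : Type*) where
  s : U → N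
  t : U → N
  n₀ : N
  sim : U × U → U × U → Prop

namespace PointedSquareGraph

variable {N U : Type*} (G : PointedSquareGraph N U)

/-- `p = u₁;u₂` is a path of length two. -/
def IsPath2 (p : U × U) : Prop := G.t p.1 = G.s p.2

/-- A (non-degenerate) commuting square `u₁;u₂ ≃ v₁;v₂` with `u₁ ≠ v₁`. -/
def Square (u₁ u₂ v₁ v₂ : U) : Prop := G.sim (u₁, u₂) (v₁, v₂) ∧ u₁ ≠ v₁

/-- The sequence of edges `w` is a path starting from the node `n`. -/
def IsPathFrom : N → List U → Prop
  | _, [] => True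
  | n, u :: w => G.s u = n ∧ IsPathFrom (G.t u) w

/-- The target of a path that starts from the node `n`. -/
def target : N → List U → N
  | n, [] => n
  | _, u :: w => target (G.t u) w

/-- One rewriting of a path along a square, in context. -/
inductive Step : List U → List U → Prop
  | mk (w₁ w₂ : List U) (u₁ u₂ v₁ v₂ : U) (h : G.sim (u₁, u₂) (v₁, v₂)) :
      Step (w₁ ++ u₁ :: u₂ :: w₂) (w₁ ++ v₁ :: v₂ :: w₂)

/-- The extension of `≃` to all paths: the equivalence generated by the contextual closure. -/
def PathEquiv : List U → List U → Prop := Relation.EqvGen G.Step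

/-- Paths from the origin. -/
def OriginPath : Type _ := {w : List U // G.IsPathFrom G.n₀ w}

/-- Equivalence of paths from the origin. -/
def pathSetoid : Setoid G.OriginPath where
  r w w' := G.PathEquiv w.1 w'.1
  iseqv := ⟨fun w => .refl w.1, fun h => .symm _ _ h, fun h h' => .trans _ _ _ h h'⟩

/-- The set `P(A)` of equivalence classes of paths from the origin. -/
def PathClass : Type _ := Quotient G.pathSetoid

/-- The class of a path from the origin. -/
def cls (w : G.OriginPath) : G.PathClass := Quotient.mk G.pathSetoid w

end PointedSquareGraph

/-- Weak asynchronous graphs: `≃` is an equivalence relation on coinitial and cofinal paths of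
length two, subject to the axioms below. The squares in `closing`, `cube` and `coherence` are
non-degenerate. -/
structure WeakAsyncGraph (N : Type*) (U : Type*) extends PointedSquareGraph N U where
  sim_path : ∀ p q, sim p q → toPointedSquareGraph.IsPath2 p ∧ toPointedSquareGraph.IsPath2 q
  sim_coinitial : ∀ p q, sim p q → s p.1 = s q.1
  sim_cofinal : ∀ p q, sim p q → t p.2 = t q.2
  sim_refl : ∀ p, toPointedSquareGraph.IsPath2 p → sim p p
  sim_symm : ∀ p q, sim p q → sim q p
  sim_trans : ∀ p q r, sim p q → sim q r → sim p r
  /-- if `u₁;u₂ ≃ v₁;v₂` and `u₂ ≠ v₂` then `u₁ ≠ v₁` -/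
  determinism : ∀ u₁ u₂ v₁ v₂, sim (u₁, u₂) (v₁, v₂) → u₂ ≠ v₂ → u₁ ≠ v₁
  /-- if `u;u₁ ≃ v₁;v₂` and `u;u₁' ≃ v₁';v₂'` are squares, then `u₁ = u₁'` iff `v₁ = v₁'` -/
  closing : ∀ u u₁ v₁ v₂ u₁' v₁' v₂',
    toPointedSquareGraph.Square u u₁ v₁ v₂ → toPointedSquareGraph.Square u u₁' v₁' v₂' →
      (u₁ = u₁' ↔ v₁ = v₁')
  /-- forward part of the cube axiom: if the three squares of the hexagon `u₁;u₂;u₃`, `v₁;v₂;v₃`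
  meeting at the node reached by `w` exist, so do the three squares on the opposite side -/
  cube : ∀ u₁ u₂ u₃ v₁ v₂ v₃ w x y,
    toPointedSquareGraph.Square u₁ u₂ w x → toPointedSquareGraph.Square v₁ v₂ w y →
    toPointedSquareGraph.Square x u₃ y v₃ →
      ∃ p q r, toPointedSquareGraph.Square u₁ p v₁ q ∧ toPointedSquareGraph.Square u₂ u₃ p r ∧
        toPointedSquareGraph.Square v₂ v₃ q r
  /-- coherence axiom: if three coinitial edges `u₁`, `v₁`, `w` pairwise span squares, then these
  squares can be completed to a cube -/
  coherence : ∀ u₁ u₂ v₁ v₂ w x y p q,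
    toPointedSquareGraph.Square u₁ u₂ w x → toPointedSquareGraph.Square v₁ v₂ w y →
    toPointedSquareGraph.Square u₁ p v₁ q →
      ∃ u₃ v₃ r, toPointedSquareGraph.Square u₂ u₃ p r ∧ toPointedSquareGraph.Square v₂ v₃ q r

namespace WeakAsyncGraph

variable {N U : Type*} (A : WeakAsyncGraph N U)

/-- A weak asynchronous graph is weak prime if all cofinal paths from the origin are
equivalent. -/
def IsWeakPrime : Prop :=
  ∀ w w' : List U, A.IsPathFrom A.n₀ w → A.IsPathFrom A.n₀ w' →
    A.target A.n₀ w = A.target A.n₀ w' → A.PathEquiv w w'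

theorem isPathFrom_step {w w' : List U} (h : A.Step w w') (n : N) :
    A.IsPathFrom n w ↔ A.IsPathFrom n w' := by
  obtain ⟨w₁, w₂, u₁, u₂, v₁, v₂, h⟩ := h
  have h1 := A.sim_path _ _ h
  have h2 := A.sim_coinitial _ _ h
  have h3 := A.sim_cofinal _ _ h
  simp only [PointedSquareGraph.IsPath2] at h1 h2 h3
  induction w₁ generalizing n with
  | nil => simp [PointedSquareGraph.IsPathFrom, h1.1, h1.2, h2, h3]
  | cons a l ih => simp [PointedSquareGraph.IsPathFrom, ih]

theorem isPathFrom_equiv {w w' : List U} (h : A.PathEquiv w w') (n : N) :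
    A.IsPathFrom n w ↔ A.IsPathFrom n w' := by
  induction h with
  | rel _ _ h => exact A.isPathFrom_step h n
  | refl => rfl
  | symm _ _ _ ih => exact ih.symm
  | trans _ _ _ _ _ ih ih' => exact ih.trans ih'

theorem pathEquiv_append {w w' : List U} (h : A.PathEquiv w w') (x : List U) :
    A.PathEquiv (w ++ x) (w' ++ x) := by
  induction h with
  | rel _ _ h =>
    obtain ⟨w₁, w₂, u₁, u₂, v₁, v₂, h⟩ := h
    have := PointedSquareGraph.Step.mk (G := A.toPointedSquareGraph) w₁ (w₂ ++ x) u₁ u₂ v₁ v₂ h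
    exact .rel _ _ (by simpa using this)
  | refl => exact .refl _
  | symm _ _ _ ih => exact .symm _ _ ih
  | trans _ _ _ _ _ ih ih' => exact .trans _ _ _ ih ih'

theorem length_eq_of_pathEquiv {w w' : List U} (h : A.PathEquiv w w') :
    w.length = w'.length := by
  induction h with
  | rel _ _ h => obtain ⟨w₁, w₂, u₁, u₂, v₁, v₂, h⟩ := h; simp
  | refl => rfl
  | symm _ _ _ ih => exact ih.symm
  | trans _ _ _ _ _ ih ih' => exact ih.trans ih'

/-- The poset `P(A)`: classes of paths from the origin ordered by prefix, that is, `c ≤ c'` when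
some path of class `c` is a prefix of some path of class `c'`. -/
instance : PartialOrder A.PathClass where
  le c c' := ∃ w w' : A.OriginPath, A.cls w = c ∧ A.cls w' = c' ∧ w.1 <+: w'.1
  le_refl c := by
    obtain ⟨w, rfl⟩ := Quotient.exists_rep c
    exact ⟨w, w, rfl, rfl, List.prefix_rfl⟩
  le_trans := by
    rintro _ _ _ ⟨w₁, w₂, rfl, rfl, h⟩ ⟨w₂', w₃, e, rfl, ⟨x, hx⟩⟩
    have e : A.PathEquiv w₂'.1 w₂.1 := Quotient.exact e
    have hE := A.pathEquiv_append e x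
    rw [hx] at hE
    exact ⟨w₁, ⟨w₂.1 ++ x, (A.isPathFrom_equiv hE _).1 w₃.2⟩, rfl,
      Quotient.sound (.symm _ _ hE), h.trans (List.prefix_append _ _)⟩
  le_antisymm := by
    rintro _ _ ⟨w₁, w₂, rfl, rfl, h⟩ ⟨w₂', w₁', e, e', h'⟩
    have e : A.PathEquiv w₂'.1 w₂.1 := Quotient.exact e
    have e' : A.PathEquiv w₁'.1 w₁.1 := Quotient.exact e'
    have l1 := A.length_eq_of_pathEquiv e
    have l2 := A.length_eq_of_pathEquiv e'
    have l3 := h'.length_le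
    have := h.eq_of_length_le (by omega)
    exact congrArg A.cls (Subtype.ext this)

end WeakAsyncGraph

universe u v w

/-! Both directions pass through the poset of compact elements, whose relevant properties are
isolated in `IsFusionOrder`: finite lower sets and local conditions on covers. Four facts then give
the theorem.

The order `P(A)` is a fusion order (`isFusionOrder_pathClass`). The key is `headEquiv_of_pathEquiv`:
two equivalent paths either share their first edge or factor through a square on their first edges.
The cube axiom makes this relation transitive; left cancellation, finiteness of classes and the
existence of joins follow.

The ideal completion of a fusion order is a weak prime domain (`isWeakPrimeDomain_ideal`). Local
squares and triples propagate to joins of compatible pairs and bounds of pairwise compatible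
triples, and `exists_interchange` shows that every irreducible is a weak prime.

The compact elements of a weak prime domain form a fusion order (`IsWeakPrimeDomain.isFusionOrder`):
a cover is induced by an irreducible, and interchangeability controls which irreducibles lie below
the join of two covers.

The covering graph of a fusion order, with all squares commuting, is a weak prime asynchronous graph
whose path classes recover the order (`pathEquiv_of_target_eq`, `nonempty_pathClass_orderIso`). A
domain being the ideal completion of its compact elements, this yields the converse. -/

/-- `d` is the join of `a` and `b`. -/
def IsJoin {P : Type*} [PartialOrder P] (a b d : P) : Prop :=
  ∀ t, d ≤ t ↔ a ≤ t ∧ b ≤ t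

/-- `a` and `b` have a common upper bound. -/
def Compatible {P : Type*} [PartialOrder P] (a b : P) : Prop :=
  ∃ t, a ≤ t ∧ b ≤ t

namespace IsJoin

variable {P : Type*} [PartialOrder P] {a b d d' : P}

theorem left (h : IsJoin a b d) : a ≤ d := ((h d).1 le_rfl).1

theorem right (h : IsJoin a b d) : b ≤ d := ((h d).1 le_rfl).2

theorem le {t : P} (h : IsJoin a b d) (ha : a ≤ t) (hb : b ≤ t) : d ≤ t := (h t).2 ⟨ha, hb⟩

theorem symm (h : IsJoin a b d) : IsJoin b a d := fun t => (h t).trans and_comm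

theorem unique (h : IsJoin a b d) (h' : IsJoin a b d') : d = d' :=
  le_antisymm (h.le h'.left h'.right) (h'.le h.left h.right)

theorem of_le (h : b ≤ a) : IsJoin a b a := fun _ => ⟨fun h' => ⟨h', h.trans h'⟩, fun h' => h'.1⟩

end IsJoin

namespace Compatible

variable {P : Type*} [PartialOrder P] {a b a' b' : P}

theorem symm (h : Compatible a b) : Compatible b a := h.imp fun _ h => h.symm

theorem mono (h : Compatible a b) (ha : a' ≤ a) (hb : b' ≤ b) : Compatible a' b' :=
  h.imp fun _ h => ⟨ha.trans h.1, hb.trans h.2⟩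

theorem of_le (h : a ≤ b) : Compatible a b := ⟨b, h, le_rfl⟩

theorem bddAbove_iff : BddAbove ({a, b} : Set P) ↔ Compatible a b := by
  constructor
  · rintro ⟨t, ht⟩
    exact ⟨t, ht (by simp), ht (by simp)⟩
  · rintro ⟨t, ha, hb⟩
    refine ⟨t, ?_⟩
    rintro x (rfl | rfl)
    · exact ha
    · exact hb

end Compatible

/-- `p` is the greatest element strictly below `i`. -/
def IsPred {P : Type*} [PartialOrder P] (p i : P) : Prop :=
  p < i ∧ ∀ x, x < i → x ≤ p

theorem IsPred.covBy {P : Type*} [PartialOrder P] {p i : P} (h : IsPred p i) : p ⋖ i :=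
  ⟨h.1, fun _ hx hx' => (h.2 _ hx').not_gt hx⟩

/-! ### Fusion orders: from local conditions on covers to joins and bounds. -/

/-- The order-theoretic properties shared by the prefix orders of weak asynchronous graphs and by
the orders of compact elements of weak prime domains. -/
structure IsFusionOrder (P : Type*) [PartialOrder P] : Prop where
  exists_bot : ∃ b : P, ∀ x, b ≤ x
  finite_Iic : ∀ x : P, (Set.Iic x).Finite
  /-- compatible covers of the same element have a join, which covers both -/
  square : ∀ {c a b : P}, c ⋖ a → c ⋖ b → a ≠ b → Compatible a b →
    ∃ d, a ⋖ d ∧ b ⋖ d ∧ IsJoin a b d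
  /-- no three covers of an element have the same pairwise join -/
  eq_of_covBy : ∀ {c a b b' d : P}, c ⋖ a → c ⋖ b → c ⋖ b' → a ≠ b → a ≠ b' → a ⋖ d →
    b ≤ d → b' ≤ d → b = b'
  /-- three pairwise compatible covers of an element are compatible -/
  triple : ∀ {c a b e : P}, c ⋖ a → c ⋖ b → c ⋖ e → Compatible a b → Compatible b e →
    Compatible a e → ∃ t, a ≤ t ∧ b ≤ t ∧ e ≤ t

namespace IsFusionOrder

variable {P : Type*} [PartialOrder P] (hP : IsFusionOrder P)
include hP

theorem induction_down {s : P} {p : P → Prop}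
    (H : ∀ c ≤ s, (∀ c', c < c' → c' ≤ s → p c') → p c) : ∀ c ≤ s, p c := by
  intro c hc
  have hw : (Set.Iic s).WellFoundedOn (· > ·) := (hP.finite_Iic s).wellFoundedOn
  exact hw.induction (show c ∈ Set.Iic s from hc) fun y hy ih => H y hy fun z hz hz' => ih z hz' hz

theorem exists_covBy {c x : P} (h : c < x) : ∃ a, c ⋖ a ∧ a ≤ x := by
  have hf : {a | c < a ∧ a ≤ x}.Finite := (hP.finite_Iic x).subset fun a ha => ha.2
  obtain ⟨a, ha⟩ := hf.exists_minimal ⟨x, h, le_rfl⟩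
  refine ⟨a, ⟨ha.prop.1, fun y hy hya => ?_⟩, ha.prop.2⟩
  exact (ha.le_of_le ⟨hy, hya.le.trans ha.prop.2⟩ hya.le).not_gt hya

/-- Squares are tiled from `c` up to the bound `s`. A square on covers `a ≤ x`, `b ≤ y` of `c` gives
`d`; then `x ∨ d` is formed above `a`, `y ∨ d` above `b`, and the two are joined above `d`. The
bound `s` serves only for termination: the result is least among all upper bounds. -/
theorem exists_isJoin_above {s : P} : ∀ c ≤ s, ∀ x y, c ≤ x → c ≤ y → x ≤ s → y ≤ s →
    ∃ z, IsJoin x y z := by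
  refine hP.induction_down fun c _ ih x y hcx hcy hx hy => ?_
  rcases hcx.eq_or_lt with rfl | hcx
  · exact ⟨y, (IsJoin.of_le hcy).symm⟩
  rcases hcy.eq_or_lt with rfl | hcy
  · exact ⟨x, IsJoin.of_le hcx.le⟩
  obtain ⟨a, hca, hax⟩ := hP.exists_covBy hcx
  obtain ⟨b, hcb, hby⟩ := hP.exists_covBy hcy
  by_cases hab : a = b
  · subst hab
    exact ih a hca.lt (hax.trans hx) x y hax hby hx hy
  obtain ⟨d, had, hbd, hd⟩ := hP.square hca hcb hab ⟨s, hax.trans hx, hby.trans hy⟩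
  have hds : d ≤ s := hd.le (hax.trans hx) (hby.trans hy)
  obtain ⟨x', hx'⟩ := ih a hca.lt (hax.trans hx) x d hax had.le hx hds
  obtain ⟨y', hy'⟩ := ih b hcb.lt (hby.trans hy) y d hby hbd.le hy hds
  obtain ⟨z, hz⟩ := ih d (hca.lt.trans had.lt) hds x' y' hx'.right hy'.right (hx'.le hx hds)
    (hy'.le hy hds)
  refine ⟨z, fun t => ⟨fun h => ⟨hx'.left.trans (hz.left.trans h), hy'.left.trans (hz.right.trans h)⟩,
    fun h => ?_⟩⟩
  have hdt : d ≤ t := hd.le (hax.trans h.1) (hby.trans h.2)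
  exact hz.le (hx'.le h.1 hdt) (hy'.le h.2 hdt)

theorem exists_isJoin {x y : P} (h : Compatible x y) : ∃ z, IsJoin x y z := by
  obtain ⟨s, hx, hy⟩ := h
  obtain ⟨b, hb⟩ := hP.exists_bot
  exact hP.exists_isJoin_above b (hb s) x y (hb x) (hb y) hx hy

/-- This and the next two lemmas extend `triple` from three covers of `c` to arbitrary elements,
freeing one element at a time. Each moves `c` to a cover `e` below the newly freed element, after
joining the other two with `e`; the previous case supplies the bound that keeps these joins
compatible. -/
theorem exists_bound_of_covBy_of_covBy {z : P} : ∀ c ≤ z, ∀ x y, c ⋖ x → c ⋖ y →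
    Compatible x y → Compatible y z → Compatible x z → ∃ t, x ≤ t ∧ y ≤ t ∧ z ≤ t := by
  refine hP.induction_down fun c hcz ih x y hx hy hxy hyz hxz => ?_
  rcases hcz.eq_or_lt with rfl | hcz
  · obtain ⟨t, h1, h2⟩ := hxy
    exact ⟨t, h1, h2, hx.le.trans h1⟩
  obtain ⟨e, hce, hez⟩ := hP.exists_covBy hcz
  by_cases hxy' : x = y
  · subst hxy'
    obtain ⟨t, h1, h2⟩ := hxz
    exact ⟨t, h1, h1, h2⟩
  by_cases hex : e = x
  · subst hex
    obtain ⟨t, h1, h2⟩ := hyz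
    exact ⟨t, hez.trans h2, h1, h2⟩
  by_cases hey : e = y
  · subst hey
    obtain ⟨t, h1, h2⟩ := hxz
    exact ⟨t, h1, hez.trans h2, h2⟩
  obtain ⟨t, hxt, hyt, het⟩ := hP.triple hx hy hce hxy (hyz.mono le_rfl hez) (hxz.mono le_rfl hez)
  obtain ⟨x', hex', hxx', hjx⟩ := hP.square hce hx hex ⟨t, het, hxt⟩
  obtain ⟨y', hey', hyy', hjy⟩ := hP.square hce hy hey ⟨t, het, hyt⟩
  have aux : ∀ {w w'}, IsJoin e w w' → Compatible w z → Compatible w' z := fun hj ⟨r, h1, h2⟩ =>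
    ⟨r, hj.le (hez.trans h2) h1, h2⟩
  obtain ⟨r, h1, h2, h3⟩ := ih e hce.lt hez x' y' hex' hey' ⟨t, hjx.le het hxt, hjy.le het hyt⟩
    (aux hjy hyz) (aux hjx hxz)
  exact ⟨r, hxx'.le.trans h1, hyy'.le.trans h2, h3⟩

theorem exists_bound_of_covBy {y : P} : ∀ c ≤ y, ∀ x z, c ⋖ x → c ≤ z →
    Compatible x y → Compatible y z → Compatible x z → ∃ t, x ≤ t ∧ y ≤ t ∧ z ≤ t := by
  refine hP.induction_down fun c hcy ih x z hx hz hxy hyz hxz => ?_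
  rcases hcy.eq_or_lt with rfl | hcy
  · obtain ⟨t, h1, h2⟩ := hxz
    exact ⟨t, h1, hx.le.trans h1, h2⟩
  obtain ⟨e, hce, hey⟩ := hP.exists_covBy hcy
  by_cases hex : e = x
  · subst hex
    obtain ⟨t, h1, h2⟩ := hyz
    exact ⟨t, hey.trans h1, h1, h2⟩
  obtain ⟨t, hxt, het, hzt⟩ := hP.exists_bound_of_covBy_of_covBy c hz x e hx hce
    (hxy.mono le_rfl hey) (hyz.mono hey le_rfl) hxz
  obtain ⟨x', hex', hxx', hjx⟩ := hP.square hce hx hex ⟨t, het, hxt⟩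
  obtain ⟨z', hjz⟩ := hP.exists_isJoin ⟨t, het, hzt⟩
  have aux : ∀ {w w'}, IsJoin e w w' → Compatible w y → Compatible w' y := fun hj ⟨r, h1, h2⟩ =>
    ⟨r, hj.le (hey.trans h2) h1, h2⟩
  obtain ⟨r, h1, h2, h3⟩ := ih e hce.lt hey x' z' hex' hjz.left (aux hjx hxy)
    (aux hjz hyz.symm).symm ⟨t, hjx.le het hxt, hjz.le het hzt⟩
  exact ⟨r, hxx'.le.trans h1, h2, hjz.right.trans h3⟩

theorem exists_bound_above {x : P} : ∀ c ≤ x, ∀ y z, c ≤ y → c ≤ z →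
    Compatible x y → Compatible y z → Compatible x z → ∃ t, x ≤ t ∧ y ≤ t ∧ z ≤ t := by
  refine hP.induction_down fun c hcx ih y z hy hz hxy hyz hxz => ?_
  rcases hcx.eq_or_lt with rfl | hcx
  · obtain ⟨t, h1, h2⟩ := hyz
    exact ⟨t, hy.trans h1, h1, h2⟩
  obtain ⟨e, hce, hex⟩ := hP.exists_covBy hcx
  obtain ⟨t, het, hyt, hzt⟩ := hP.exists_bound_of_covBy c hy e z hce hz
    (hxy.mono hex le_rfl) hyz (hxz.mono hex le_rfl)
  obtain ⟨y', hjy⟩ := hP.exists_isJoin ⟨t, het, hyt⟩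
  obtain ⟨z', hjz⟩ := hP.exists_isJoin ⟨t, het, hzt⟩
  have aux : ∀ {w w'}, IsJoin e w w' → Compatible x w → Compatible x w' := fun hj ⟨r, h1, h2⟩ =>
    ⟨r, h1, hj.le (hex.trans h1) h2⟩
  obtain ⟨r, h1, h2, h3⟩ := ih e hce.lt hex y' z' hjy.left hjz.left (aux hjy hxy)
    ⟨t, hjy.le het hyt, hjz.le het hzt⟩ (aux hjz hxz)
  exact ⟨r, h1, hjy.right.trans h2, hjz.right.trans h3⟩

theorem exists_bound {x y z : P} (hxy : Compatible x y) (hyz : Compatible y z)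
    (hxz : Compatible x z) : ∃ t, x ≤ t ∧ y ≤ t ∧ z ≤ t := by
  obtain ⟨b, hb⟩ := hP.exists_bot
  exact hP.exists_bound_above b (hb x) y z (hb y) (hb z) hxy hyz hxz

/-- The compatibility clause is what lets the induction continue: a new element compatible with
every member of `F` must be compatible with the join of `F`. -/
theorem exists_isLUB_of_finite {F : Set P} (hF : F.Finite)
    (h : ∀ x ∈ F, ∀ y ∈ F, Compatible x y) :
    ∃ f, IsLUB F f ∧ ∀ a, (∀ x ∈ F, Compatible a x) → Compatible a f := by
  induction F, hF using Set.Finite.induction_on with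
  | empty =>
    obtain ⟨b, hb⟩ := hP.exists_bot
    exact ⟨b, isLUB_empty_iff.2 hb, fun a _ => ⟨a, le_rfl, hb a⟩⟩
  | @insert b F _ _ ih =>
    obtain ⟨f, hf, hf'⟩ := ih fun x hx y hy => h x (.inr hx) y (.inr hy)
    have hbf : Compatible b f := hf' b fun x hx => h b (.inl rfl) x (.inr hx)
    obtain ⟨g, hg⟩ := hP.exists_isJoin hbf
    refine ⟨g, ⟨?_, fun t ht => hg.le (ht (.inl rfl)) (hf.2 fun x hx => ht (.inr hx))⟩,
      fun a ha => ?_⟩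
    · rintro x (rfl | hx)
      · exact hg.left
      · exact (hf.1 hx).trans hg.right
    · obtain ⟨t, h1, h2, h3⟩ := hP.exists_bound (ha b (.inl rfl)) hbf
        (hf' a fun x hx => ha x (.inr hx))
      exact ⟨t, h1, hg.le h2 h3⟩

/-- Upper semimodularity: the cover `c ⋖ a` is transported along a chain of covers from `c` to `m`,
one square at a time. -/
theorem covBy_of_isJoin {m : P} : ∀ c ≤ m, ∀ a, c ⋖ a → ¬ a ≤ m → Compatible a m →
    ∃ d, m ⋖ d ∧ IsJoin a m d := by
  refine hP.induction_down fun c hcm ih a hca ham hc => ?_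
  rcases hcm.eq_or_lt with rfl | hcm
  · exact ⟨a, hca, IsJoin.of_le hca.le⟩
  obtain ⟨e, hce, hem⟩ := hP.exists_covBy hcm
  have hae : a ≠ e := fun h => ham (h ▸ hem)
  obtain ⟨d, had, hed, hj⟩ := hP.square hca hce hae (hc.mono le_rfl hem)
  obtain ⟨t, hat, hmt⟩ := hc
  obtain ⟨g, hmg, hg⟩ := ih e hce.lt hem d hed (fun h => ham (had.le.trans h))
    ⟨t, hj.le hat (hem.trans hmt), hmt⟩
  refine ⟨g, hmg, fun r => ⟨fun h => ⟨had.le.trans (hg.left.trans h), hg.right.trans h⟩, fun h =>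
    hg.le (hj.le h.1 (hem.trans h.2)) h.2⟩⟩

/-- Both covers are pushed up to a cover `e` of `c` below `m`, where they coincide by induction;
then `e`, `a`, `b` are covers of `c` below one cover of `e`, so `eq_of_covBy` applies. -/
theorem eq_of_covBy_of_le {m n : P} (hmn : m ⋖ n) : ∀ c ≤ m, ∀ a b, c ⋖ a → c ⋖ b →
    ¬ a ≤ m → ¬ b ≤ m → a ≤ n → b ≤ n → a = b := by
  refine hP.induction_down fun c hcm ih a b hca hcb ham hbm han hbn => ?_
  rcases hcm.eq_or_lt with rfl | hcm
  · have key : ∀ {x}, c ⋖ x → x ≤ n → x = n := fun hx hxn =>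
      hxn.eq_or_lt.resolve_right (hmn.2 hx.lt)
    rw [key hca han, key hcb hbn]
  obtain ⟨e, hce, hem⟩ := hP.exists_covBy hcm
  have hen := hem.trans hmn.le
  have hea : e ≠ a := fun h => ham (h ▸ hem)
  have heb : e ≠ b := fun h => hbm (h ▸ hem)
  obtain ⟨a', hea', haa', hja⟩ := hP.square hce hca hea ⟨n, hen, han⟩
  obtain ⟨b', heb', hbb', hjb⟩ := hP.square hce hcb heb ⟨n, hen, hbn⟩
  have := ih e hce.lt hem a' b' hea' heb' (fun h => ham (haa'.le.trans h))
    (fun h => hbm (hbb'.le.trans h)) (hja.le hen han) (hjb.le hen hbn)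
  subst this
  exact hP.eq_of_covBy hce hca hcb hea heb hea' haa'.le hbb'.le

/-- If `i`, with predecessor `p`, lies below the join of `F`, then some element of `F` is above an
element `j`, with predecessor `p'`, such that `i` and `j` are interchangeable above the join of `p`
and `p'`. -/
theorem exists_interchange {p i s : P} {F : Set P} (hi : IsPred p i) (hs : IsLUB F s)
    (his : i ≤ s) : ∃ x ∈ F, ∃ j ≤ x, ∃ p', IsPred p' j ∧ ∃ q, IsJoin p p' q ∧ ¬ i ≤ q ∧ ¬ j ≤ q ∧
      Compatible i q ∧ Compatible j q ∧ ∀ t, q ≤ t → (i ≤ t ↔ j ≤ t) := by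
  -- A maximal `m` is chosen between `p` and `s` not above `i`: any strictly larger element below
  -- `s` is above `i`.
  have hf : {m | p ≤ m ∧ m ≤ s ∧ ¬ i ≤ m}.Finite := (hP.finite_Iic s).subset fun m hm => hm.2.1
  obtain ⟨m, hm⟩ := hf.exists_maximal ⟨p, le_rfl, hi.1.le.trans his, hi.1.not_ge⟩
  obtain ⟨hpm, hms, him⟩ := hm.prop
  have hmax : ∀ {y}, m < y → y ≤ s → i ≤ y := fun {y} hy hys => by
    by_contra h
    exact hy.not_ge (hm.le_of_ge ⟨hpm.trans hy.le, hys, h⟩ hy.le)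
  obtain ⟨x, hxF, hxm⟩ : ∃ x ∈ F, ¬ x ≤ m := by
    by_contra! h
    exact him (his.trans (hs.2 h))
  -- By minimality of `j`, everything strictly below it is below `m`; so the join `p'` of these
  -- elements is below `m` and differs from `j`.
  have hf' : {j | j ≤ x ∧ ¬ j ≤ m}.Finite := (hP.finite_Iic x).subset fun j hj => hj.1
  obtain ⟨j, hj⟩ := hf'.exists_minimal ⟨x, le_rfl, hxm⟩
  obtain ⟨hjx, hjm⟩ := hj.prop
  have hjs : j ≤ s := hjx.trans (hs.1 hxF)
  have hmin : ∀ {y}, y < j → y ≤ m := fun {y} hy => by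
    by_contra h
    exact hy.not_ge (hj.le_of_le ⟨hy.le.trans hjx, h⟩ hy.le)
  have hfb : {y | y < j}.Finite := (hP.finite_Iic j).subset fun y hy => le_of_lt hy
  obtain ⟨p', hp', -⟩ := hP.exists_isLUB_of_finite hfb fun y hy z hz =>
    ⟨j, le_of_lt hy, le_of_lt hz⟩
  have hp'm : p' ≤ m := hp'.2 fun y hy => hmin hy
  have hpj : IsPred p' j := by
    refine ⟨(hp'.2 fun y hy => le_of_lt hy).lt_of_ne ?_, fun y hy => hp'.1 hy⟩
    rintro rfl
    exact hjm hp'm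
  obtain ⟨q, hq⟩ := hP.exists_isJoin ⟨m, hpm, hp'm⟩
  have hqm := hq.le hpm hp'm
  have hqs := hqm.trans hms
  have hiq : ¬ i ≤ q := fun h => him (h.trans hqm)
  have hjq : ¬ j ≤ q := fun h => hjm (h.trans hqm)
  refine ⟨x, hxF, j, hjx, p', hpj, q, hq, hiq, hjq, ⟨s, his, hqs⟩, ⟨s, hjs, hqs⟩, ?_⟩
  obtain ⟨a, hqa, ha⟩ := hP.covBy_of_isJoin p hq.left i hi.covBy hiq ⟨s, his, hqs⟩
  obtain ⟨b, hqb, hb⟩ := hP.covBy_of_isJoin p' hq.right j hpj.covBy hjq ⟨s, hjs, hqs⟩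
  obtain ⟨n, hmn, hn⟩ := hP.covBy_of_isJoin p' hp'm j hpj.covBy hjm ⟨s, hjs, hms⟩
  have hin : i ≤ n := hmax hmn.lt (hn.le hjs hms)
  -- The covers `i ∨ q` and `j ∨ q` of `q` both lie below `n = j ∨ m` and not below `m`, and `m ⋖ n`
  -- leaves room for only one such cover.
  have hab : a = b := hP.eq_of_covBy_of_le hmn q hqm a b hqa hqb (fun h => him (ha.left.trans h))
    (fun h => hjm (hb.left.trans h)) (ha.le hin (hqm.trans hmn.le)) (hb.le hn.left (hqm.trans hmn.le))
  subst hab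
  exact fun t ht => ⟨fun h => hb.left.trans (ha.le h ht), fun h => ha.left.trans (hb.le h ht)⟩

end IsFusionOrder

/-! ### Compact elements, irreducibles and interchangeability in domains. -/

theorem Set.Finite.exists_bound_of_directedOn {α : Type*} [Preorder α] {X S : Set α}
    (hX : X.Finite) (hne : S.Nonempty) (hS : DirectedOn (· ≤ ·) S)
    (h : ∀ x ∈ X, ∃ y ∈ S, x ≤ y) : ∃ y ∈ S, ∀ x ∈ X, x ≤ y := by
  induction X, hX using Set.Finite.induction_on with
  | empty => exact hne.imp fun y hy => ⟨hy, by simp⟩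
  | @insert a X _ _ ih =>
    obtain ⟨y, hy, hXy⟩ := ih fun x hx => h x (.inr hx)
    obtain ⟨z, hz, haz⟩ := h a (.inl rfl)
    obtain ⟨w, hw, hyw, hzw⟩ := hS y hy z hz
    refine ⟨w, hw, ?_⟩
    rintro x (rfl | hx)
    exacts [haz.trans hzw, (hXy x hx).trans hyw]

namespace WeakPrimeDom

variable {D : Type*} [PartialOrder D]

namespace IsDomainOrder

theorem exists_isLUB (hD : IsDomainOrder D) {X : Set D} (h : BddAbove X) : ∃ s, IsLUB X s := by
  obtain ⟨t, ht⟩ := h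
  exact hD.coherent X fun x hx y hy => Compatible.bddAbove_iff.2 ⟨t, ht hx, ht hy⟩

theorem isCompactElement_isLUB {X : Set D} (hX : X.Finite)
    (hc : ∀ x ∈ X, IsCompactElement x) {s : D} (hs : IsLUB X s) : IsCompactElement s := by
  intro S u hne hdir hu hsu
  obtain ⟨y, hy, h⟩ := hX.exists_bound_of_directedOn hne hdir fun x hx =>
    hc x hx S u hne hdir hu ((hs.1 hx).trans hsu)
  exact ⟨y, hy, hs.2 h⟩

/-- By finitarity `x` is the join of only finitely many compact elements. -/
theorem isCompactElement_of_le (hD : IsDomainOrder D) {x c : D} (hc : IsCompactElement c)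
    (h : x ≤ c) : IsCompactElement x :=
  isCompactElement_isLUB ((hD.finitary c hc).subset fun _ hy => hy.1.trans h)
    (fun _ hy => hy.2) (hD.algebraic x)

theorem le_of_forall_compact (hD : IsDomainOrder D) {x y : D}
    (h : ∀ c, IsCompactElement c → c ≤ x → c ≤ y) : x ≤ y :=
  (hD.algebraic x).2 fun c hc => h c hc.2 hc.1

/-- The predecessor of an irreducible element. -/
theorem exists_isPred (hD : IsDomainOrder D) {i : D} (hi : IsIrreducible i) :
    ∃ p, IsPred p i := by
  obtain ⟨p, hp⟩ := hD.exists_isLUB (X := {x | x < i}) ⟨i, fun x hx => le_of_lt hx⟩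
  have hpi : p ≤ i := hp.2 fun x hx => le_of_lt hx
  refine ⟨p, hpi.lt_of_ne ?_, fun x hx => hp.1 hx⟩
  rintro rfl
  refine lt_irrefl p (hi.2 {x | x < p} (fun x hx => hD.isCompactElement_of_le hi.1 (le_of_lt hx))
    (fun x hx y hy => Compatible.bddAbove_iff.2 ⟨p, le_of_lt hx, le_of_lt hy⟩) hp)

end IsDomainOrder

theorem isIrreducible_of_isPred {p i : D} (hi : IsCompactElement i) (h : IsPred p i) :
    IsIrreducible i := by
  refine ⟨hi, fun X _ _ hX => ?_⟩
  by_contra hiX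
  refine h.1.not_ge (hX.2 fun x hx => h.2 x ((hX.1 hx).lt_of_ne ?_))
  rintro rfl
  exact hiX hx

/-- A minimal element `j` not below `t` is irreducible, since everything strictly below `j` is
bounded by `t`. The last clause places the predecessor of `j` below `t`. -/
theorem IsDomainOrder.exists_irreducible (hD : IsDomainOrder D) {x t : D} (h : ¬ x ≤ t) :
    ∃ j ≤ x, IsIrreducible j ∧ ¬ j ≤ t ∧ ∀ z < j, z ≤ t := by
  obtain ⟨c, hc, hcx, hct⟩ : ∃ c, IsCompactElement c ∧ c ≤ x ∧ ¬ c ≤ t := by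
    by_contra! h'
    exact h (hD.le_of_forall_compact h')
  have hf : {j | j ≤ c ∧ ¬ j ≤ t}.Finite := (hD.finitary c hc).subset fun j hj => hj.1
  obtain ⟨j, hj⟩ := hf.exists_minimal ⟨c, le_rfl, hct⟩
  have hmin : ∀ z < j, z ≤ t := fun z hz => by
    by_contra h
    exact hz.not_ge (hj.le_of_le ⟨hz.le.trans hj.prop.1, h⟩ hz.le)
  refine ⟨j, hj.prop.1.trans hcx, ⟨hD.isCompactElement_of_le hc hj.prop.1, fun X _ _ hX => ?_⟩,
    hj.prop.2, hmin⟩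
  by_contra hjX
  refine hj.prop.2 (hX.2 fun x hx => hmin x ((hX.1 hx).lt_of_ne ?_))
  rintro rfl
  exact hjX hx

theorem IsDomainOrder.isLUB_irreducible (hD : IsDomainOrder D) (x : D) :
    IsLUB {j | IsIrreducible j ∧ j ≤ x} x := by
  refine ⟨fun j hj => hj.2, fun t ht => ?_⟩
  by_contra h
  obtain ⟨j, hjx, hj, hjt, -⟩ := hD.exists_irreducible h
  exact hjt (ht ⟨hj, hjx⟩)

theorem isConsistentDownset_union {c k p t : D} (hk : IsIrreducible k) (hp : IsPred p k)
    (hpc : p ≤ c) (hkt : k ≤ t) (hct : c ≤ t) :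
    IsConsistentDownset ({j | IsIrreducible j ∧ j ≤ c} ∪ {k}) := by
  refine ⟨?_, ?_, t, ?_⟩
  · rintro x (hx | rfl)
    exacts [hx.1, hk]
  · rintro x (hx | rfl) j hj hjx
    · exact .inl ⟨hj, hjx.trans hx.2⟩
    · rcases hjx.eq_or_lt with rfl | hjx
      · exact .inr rfl
      · exact .inl ⟨hj, (hp.2 j hjx).trans hpc⟩
  · rintro x (hx | rfl)
    exacts [hx.2.trans hct, hkt]

/-- The working form of interchangeability, obtained with `X` the set of irreducibles below `c`:
above an element containing both predecessors and compatible with `j`, `i` forces `j`. -/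
theorem Interchangeable.le_of_le {i j p p' c t : D}
    (h : Interchangeable i j) (hp : IsPred p i) (hp' : IsPred p' j) (hpc : p ≤ c) (hpc' : p' ≤ c)
    (hjc : Compatible j c) (hct : c ≤ t) (hit : i ≤ t) : j ≤ t := by
  obtain ⟨r, hjr, hcr⟩ := hjc
  obtain ⟨s, hs, hs'⟩ := h.2.2.1 {j | IsIrreducible j ∧ j ≤ c}
    (isConsistentDownset_union h.1 hp hpc hit hct)
    (isConsistentDownset_union h.2.1 hp' hpc' hjr hcr)
  refine (hs'.1 (.inr rfl)).trans (hs.2 ?_)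
  rintro x (hx | rfl)
  exacts [hx.2.trans hct, hit]

/-- It suffices to compare `i` and `j` above `p ∨ p'`: when `X ∪ {i}` and `X ∪ {j}` are downsets,
`X` contains all irreducibles below `p` and `p'`, so its upper bounds lie above `q`. The
irreducibles below `q` give the nondegenerate witness. -/
theorem interchangeable_of_isJoin (hD : IsDomainOrder D) {i j p p' q : D} (hi : IsIrreducible i)
    (hj : IsIrreducible j) (hp : IsPred p i) (hp' : IsPred p' j) (hq : IsJoin p p' q)
    (hiq : ¬ i ≤ q) (hic : Compatible i q) (hjc : Compatible j q)
    (h : ∀ t, q ≤ t → (i ≤ t ↔ j ≤ t)) : Interchangeable i j := by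
  have aux : ∀ {X : Set D} {k r t : D}, IsConsistentDownset (X ∪ {k}) → IsPred r k →
      IsIrreducible k → t ∈ upperBounds X → r ≤ t := by
    intro X k r t hX hr hk ht
    refine (hD.isLUB_irreducible r).2 fun l hl => ht ?_
    have hlk : l < k := hl.2.trans_lt hr.1
    exact (hX.2.1 k (.inr rfl) l hl.1 hlk.le).resolve_right hlk.ne
  refine ⟨hi, hj, fun X hXi hXj => ?_, {j | IsIrreducible j ∧ j ≤ q}, ?_, ?_, q, ?_⟩
  · obtain ⟨s, hs⟩ := hD.exists_isLUB hXi.2.2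
    refine ⟨s, hs, ?_⟩
    have : upperBounds (X ∪ {i}) = upperBounds (X ∪ {j}) := by
      ext t
      simp only [upperBounds_union, upperBounds_singleton, Set.mem_inter_iff, Set.mem_Ici]
      refine and_congr_right fun ht => h t (hq.le ?_ ?_)
      · exact aux hXi hp hi ht
      · exact aux hXj hp' hj ht
    rwa [IsLUB, ← this]
  · obtain ⟨t, hit, hqt⟩ := hic
    exact isConsistentDownset_union hi hp hq.left hit hqt
  · obtain ⟨t, hjt, hqt⟩ := hjc
    exact isConsistentDownset_union hj hp' hq.right hjt hqt
  · obtain ⟨t, hit, hqt⟩ := hic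
    obtain ⟨b, hb⟩ := hD.exists_isLUB (isConsistentDownset_union hi hp hq.left hit hqt).2.2
    refine ⟨b, hD.isLUB_irreducible q, hb, ?_⟩
    rintro rfl
    exact hiq (hb.1 (.inr rfl))

end WeakPrimeDom

/-! ### The ideal completion of a fusion order is a weak prime domain. -/

namespace IsFusionOrder

open Order

variable {P : Type*} [PartialOrder P] (hP : IsFusionOrder P)

theorem isCompactElement_principal {P : Type*} [PartialOrder P] (p : P) :
    IsCompactElement (Ideal.principal p) := by
  intro S u hne hdir hu hpu
  have hI : IsIdeal (⋃ I ∈ S, (I : Set P)) := by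
    refine ⟨?_, ?_, ?_⟩
    · intro x y hyx hx
      simp only [Set.mem_iUnion] at hx ⊢
      obtain ⟨I, hI, hx⟩ := hx
      exact ⟨I, hI, I.lower hyx hx⟩
    · obtain ⟨I, hI⟩ := hne
      exact I.nonempty.mono (Set.subset_biUnion_of_mem hI)
    · intro x hx y hy
      simp only [Set.mem_iUnion] at hx hy
      obtain ⟨I, hI, hx⟩ := hx
      obtain ⟨J, hJ, hy⟩ := hy
      obtain ⟨K, hK, hIK, hJK⟩ := hdir I hI J hJ
      obtain ⟨z, hz, h⟩ := K.directed x (hIK hx) y (hJK hy)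
      exact ⟨z, Set.mem_biUnion hK hz, h⟩
  have hle : u ≤ hI.toIdeal := hu.2 fun I hI x hx => Set.mem_biUnion hI hx
  have hp : p ∈ hI.toIdeal := hle (Ideal.principal_le_iff.1 hpu)
  obtain ⟨I, hI, hpI⟩ : ∃ I ∈ S, p ∈ I := by
    simpa only [Ideal.mem_toIdeal, Set.mem_iUnion, exists_prop, SetLike.mem_coe] using hp
  exact ⟨I, hI, Ideal.principal_le_iff.2 hpI⟩

theorem isLUB_principal {P : Type*} [PartialOrder P] (I : Ideal P) :
    IsLUB (Ideal.principal '' (I : Set P)) I := by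
  constructor
  · rintro _ ⟨p, hp, rfl⟩
    exact Ideal.principal_le_iff.2 hp
  · exact fun J hJ p hp => Ideal.principal_le_iff.1 (hJ ⟨p, hp, rfl⟩)

theorem isCompactElement_ideal_iff {P : Type*} [PartialOrder P] {I : Ideal P} :
    IsCompactElement I ↔ ∃ p, Ideal.principal p = I := by
  refine ⟨fun h => ?_, ?_⟩
  · obtain ⟨_, ⟨p, hp, rfl⟩, hIp⟩ := h _ I (I.nonempty.image _) (by
      rintro _ ⟨p, hp, rfl⟩ _ ⟨q, hq, rfl⟩
      obtain ⟨r, hr, hpr, hqr⟩ := I.directed p hp q hq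
      exact ⟨_, ⟨r, hr, rfl⟩, Ideal.principal_le_iff.2 hpr, Ideal.principal_le_iff.2 hqr⟩)
      (isLUB_principal I) le_rfl
    exact ⟨p, le_antisymm (Ideal.principal_le_iff.2 hp) hIp⟩
  · rintro ⟨p, rfl⟩
    exact isCompactElement_principal p

include hP

/-- The supremum consists of the elements below finite joins from the union of `X`; these joins
exist because pairwise consistency of `X` makes the union pairwise compatible. The second clause
reduces questions about arbitrary suprema to finite sets. -/
theorem exists_isLUB_ideal {X : Set (Ideal P)} (hX : WeakPrimeDom.PairwiseConsistent X) :
    ∃ I, IsLUB X I ∧ ∀ p ∈ I, ∃ F : Set P, F.Finite ∧ F ⊆ (⋃ I ∈ X, (I : Set P)) ∧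
      ∃ f, IsLUB F f ∧ p ≤ f := by
  have hU : ∀ F : Set P, F.Finite → F ⊆ (⋃ I ∈ X, (I : Set P)) → ∃ f, IsLUB F f := by
    intro F hF hFU
    obtain ⟨f, hf, -⟩ := hP.exists_isLUB_of_finite hF fun x hx y hy => by
      have hx := hFU hx
      have hy := hFU hy
      simp only [Set.mem_iUnion] at hx hy
      obtain ⟨I, hI, hx⟩ := hx
      obtain ⟨J, hJ, hy⟩ := hy
      obtain ⟨K, hK⟩ := hX I hI J hJ
      obtain ⟨z, -, h⟩ := K.directed x (hK (.inl rfl) hx) y (hK (.inr rfl) hy)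
      exact ⟨z, h⟩
    exact ⟨f, hf⟩
  have hI : IsIdeal {p : P | ∃ F : Set P, F.Finite ∧ F ⊆ (⋃ I ∈ X, (I : Set P)) ∧
      ∀ t ∈ upperBounds F, p ≤ t} := by
    refine ⟨?_, ?_, ?_⟩
    · rintro x y hyx ⟨F, hF, hFU, h⟩
      exact ⟨F, hF, hFU, fun t ht => hyx.trans (h t ht)⟩
    · obtain ⟨b, hb⟩ := hP.exists_bot
      exact ⟨b, ∅, Set.finite_empty, Set.empty_subset _, fun t _ => hb t⟩
    · rintro x ⟨F, hF, hFU, hx⟩ y ⟨G, hG, hGU, hy⟩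
      obtain ⟨f, hf⟩ := hU (F ∪ G) (hF.union hG) (Set.union_subset hFU hGU)
      exact ⟨f, ⟨F ∪ G, hF.union hG, Set.union_subset hFU hGU, fun t ht => hf.2 ht⟩,
        hx f fun z hz => hf.1 (.inl hz), hy f fun z hz => hf.1 (.inr hz)⟩
  refine ⟨hI.toIdeal, ⟨fun I hIX p hp => ?_, fun J hJ p hp => ?_⟩, fun p hp => ?_⟩
  · exact ⟨{p}, Set.finite_singleton p, Set.singleton_subset_iff.2 (Set.mem_biUnion hIX hp),
      fun t ht => ht rfl⟩
  · obtain ⟨F, hF, hFU, h⟩ := hp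
    obtain ⟨t, htJ, ht⟩ := hF.exists_bound_of_directedOn J.nonempty J.directed fun x hx => by
      have hx := hFU hx
      simp only [Set.mem_iUnion] at hx
      obtain ⟨I, hI, hx⟩ := hx
      exact ⟨x, hJ hI hx, le_rfl⟩
    exact J.lower (h t ht) htJ
  · obtain ⟨F, hF, hFU, h⟩ := hp
    obtain ⟨f, hf⟩ := hU F hF hFU
    exact ⟨F, hF, hFU, f, hf, h f hf.1⟩

theorem isDomainOrder_ideal : WeakPrimeDom.IsDomainOrder (Ideal P) where
  coherent _ hX := (hP.exists_isLUB_ideal hX).imp fun _ h => h.1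
  algebraic I := by
    refine ⟨fun J hJ => hJ.1, fun J hJ => (isLUB_principal I).2 ?_⟩
    rintro _ ⟨p, hp, rfl⟩
    exact hJ ⟨Ideal.principal_le_iff.2 hp, isCompactElement_principal p⟩
  finitary I hI := by
    obtain ⟨p, rfl⟩ := isCompactElement_ideal_iff.1 hI
    refine Set.Finite.of_finite_image (f := fun I : Ideal P => (I : Set P))
      ((hP.finite_Iic p).finite_subsets.subset ?_) SetLike.coe_injective.injOn
    rintro _ ⟨J, hJ, rfl⟩
    exact fun x hx => Ideal.mem_principal.1 (hJ hx)

/-- The ideal is principal, generated by an element with a predecessor, and lies below a join of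
finitely many elements of the union of `X`. Thus `exists_interchange` applies, and its conclusion
passes to principal ideals. -/
theorem isWeakPrime_ideal {I : Ideal P} (hI : WeakPrimeDom.IsIrreducible I) :
    WeakPrimeDom.IsWeakPrime I := by
  have hD := hP.isDomainOrder_ideal
  refine ⟨hI, fun X s _ hs hIs => ?_⟩
  have irr : ∀ {p i : P}, IsPred p i → IsPred (Ideal.principal p) (Ideal.principal i) := by
    intro p i h
    refine ⟨?_, fun J hJ => ?_⟩
    · simpa [lt_iff_le_not_ge, Ideal.principal_le_iff] using h.1
    · obtain ⟨x, rfl⟩ := isCompactElement_ideal_iff.1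
        (hD.isCompactElement_of_le (isCompactElement_principal i) hJ.le)
      have hxi : x < i := by simpa [lt_iff_le_not_ge, Ideal.principal_le_iff] using hJ
      simpa [Ideal.principal_le_iff] using h.2 x hxi
  obtain ⟨i, rfl⟩ := isCompactElement_ideal_iff.1 hI.1
  obtain ⟨p, hp⟩ : ∃ p, IsPred p i := by
    obtain ⟨J, hJ⟩ := hD.exists_isPred hI
    obtain ⟨p, rfl⟩ := isCompactElement_ideal_iff.1 (hD.isCompactElement_of_le hI.1 hJ.1.le)
    refine ⟨p, ?_, fun x hx => ?_⟩
    · simpa [lt_iff_le_not_ge, Ideal.principal_le_iff] using hJ.1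
    · have := hJ.2 (.principal x)
        (by simpa [lt_iff_le_not_ge, Ideal.principal_le_iff] using hx)
      simpa [Ideal.principal_le_iff] using this
  obtain ⟨I, hI', hF⟩ := hP.exists_isLUB_ideal (X := X) fun J hJ K hK =>
    Compatible.bddAbove_iff.2 ⟨s, hs.1 hJ, hs.1 hK⟩
  obtain rfl := hI'.unique hs
  obtain ⟨F, -, hFX, f, hf, hif⟩ := hF i (Ideal.principal_le_iff.1 hIs)
  obtain ⟨x, hxF, j, hjx, p', hp', q, hq, hiq, hjq, hic, hjc, h⟩ := hP.exists_interchange hp hf hif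
  obtain ⟨J, hJX, hxJ⟩ : ∃ J ∈ X, x ∈ J := by
    simpa only [Set.mem_iUnion, exists_prop, SetLike.mem_coe] using hFX hxF
  have hj := WeakPrimeDom.isIrreducible_of_isPred (isCompactElement_principal j) (irr hp')
  have comp : ∀ {a b : P}, Compatible a b → Compatible (Ideal.principal a) (Ideal.principal b) :=
    fun ⟨t, h1, h2⟩ => ⟨.principal t, Ideal.principal_le_iff.2 h1, Ideal.principal_le_iff.2 h2⟩
  refine ⟨.principal j, WeakPrimeDom.interchangeable_of_isJoin hD hI hj (irr hp) (irr hp')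
    (q := .principal q) ?_ (fun h => hiq (Ideal.principal_le_iff.1 h)) (comp hic) (comp hjc) ?_,
    J, hJX, Ideal.principal_le_iff.2 (J.lower hjx hxJ)⟩
  · intro K
    simp only [Ideal.principal_le_iff]
    refine ⟨fun h => ⟨K.lower hq.left h, K.lower hq.right h⟩, fun h => ?_⟩
    obtain ⟨t, ht, h1, h2⟩ := K.directed p h.1 p' h.2
    exact K.lower (hq.le h1 h2) ht
  · intro K
    simp only [Ideal.principal_le_iff]
    intro hqK
    constructor
    · intro hiK
      obtain ⟨t, ht, h1, h2⟩ := K.directed q hqK i hiK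
      exact K.lower ((h t h1).1 h2) ht
    · intro hjK
      obtain ⟨t, ht, h1, h2⟩ := K.directed q hqK j hjK
      exact K.lower ((h t h1).2 h2) ht

theorem isWeakPrimeDomain_ideal : WeakPrimeDom.IsWeakPrimeDomain (Ideal P) where
  isDomainOrder := hP.isDomainOrder_ideal
  weakPrimeAlgebraic I := by
    refine ⟨fun J hJ => hJ.1, fun J hJ => ?_⟩
    refine (hP.isDomainOrder_ideal.isLUB_irreducible I).2 fun K hK => ?_
    exact hJ ⟨hK.2, hP.isWeakPrime_ideal hK.1⟩

end IsFusionOrder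

/-! ### The compact elements of a weak prime domain form a fusion order. -/

namespace WeakPrimeDom

variable {D : Type*} [PartialOrder D]

theorem Interchangeable.symm {i j : D} (h : Interchangeable i j) : Interchangeable j i := by
  obtain ⟨hi, hj, hall, X, hXi, hXj, a, b, ha, hb, hab⟩ := h
  refine ⟨hj, hi, fun X h1 h2 => (hall X h2 h1).imp fun _ h => h.symm, X, hXj, hXi, a, b, ha, ?_,
    hab⟩
  obtain ⟨s, hs, hs'⟩ := hall X hXi hXj
  rwa [hb.unique hs]

theorem IsDomainOrder.exists_isJoin (hD : IsDomainOrder D) {a b : D} (h : Compatible a b) :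
    ∃ d, IsJoin a b d := by
  obtain ⟨d, hd⟩ := hD.exists_isLUB (Compatible.bddAbove_iff.2 h)
  exact ⟨d, fun t => by simp [isLUB_le_iff hd, upperBounds_insert]⟩

/-- A covering pair `c ⋖ a` is induced by an irreducible. -/
theorem IsDomainOrder.exists_irreducible_of_covBy (hD : IsDomainOrder D) {c a : D} (h : c ⋖ a) :
    ∃ i p, IsIrreducible i ∧ IsPred p i ∧ p ≤ c ∧ ¬ i ≤ c ∧ IsJoin c i a := by
  obtain ⟨i, hia, hi, hic, hlt⟩ := hD.exists_irreducible h.lt.not_ge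
  obtain ⟨p, hp⟩ := hD.exists_isPred hi
  obtain ⟨z, hz⟩ := hD.exists_isJoin ⟨a, h.le, hia⟩
  have hcz : c < z := hz.left.lt_of_ne (by rintro rfl; exact hic hz.right)
  obtain rfl : z = a := (hz.le h.le hia).eq_or_lt.resolve_right (h.2 hcz)
  exact ⟨i, p, hi, hp, hlt p hp.1, hic, hz⟩

namespace IsWeakPrimeDomain

variable (hW : IsWeakPrimeDomain D)
include hW

/-- An irreducible is the join of the weak primes below it, hence is one of them. -/
theorem isWeakPrime {i : D} (hi : IsIrreducible i) : IsWeakPrime i :=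
  (hi.2 {p | p ≤ i ∧ IsWeakPrime p} (fun _ hx => hx.2.1.1)
    (fun _ hx _ hy => Compatible.bddAbove_iff.2 ⟨i, hx.1, hy.1⟩) (hW.weakPrimeAlgebraic i)).2

/-- An irreducible below the join of two covers `a`, `b` of `c` is interchangeable with an
irreducible below `c` or below one of the irreducibles inducing the covers. -/
theorem exists_interchangeable {c i j a b d k : D} (ha : IsJoin c i a) (hb : IsJoin c j b)
    (hd : IsJoin a b d) (hk : IsIrreducible k) (hkd : k ≤ d) :
    ∃ l p, Interchangeable k l ∧ IsPred p l ∧ (l ≤ c ∨ l ≤ i ∨ l ≤ j) := by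
  have hlub : IsLUB {c, i, j} d := by
    rw [isLUB_iff_le_iff]
    intro t
    simp only [hd t, ha t, hb t, upperBounds_insert, upperBounds_singleton, Set.mem_inter_iff,
      Set.mem_Ici]
    tauto
  obtain ⟨l, hl, x, hx, hlx⟩ := (hW.isWeakPrime hk).2 _ d ⟨d, hlub.1⟩ hlub hkd
  obtain ⟨p, hp⟩ := hW.isDomainOrder.exists_isPred hl.2.1
  refine ⟨l, p, hl, hp, ?_⟩
  rcases hx with rfl | rfl | rfl
  exacts [.inl hlx, .inr (.inl hlx), .inr (.inr hlx)]

/-- If `a < e < d`, an irreducible `k ≤ e` new above `a` is interchangeable with some `l` below `c`,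
`i` or `j`. Since `l ≤ a` would force `k ≤ a`, only `l = j` remains; then `k ≤ e` forces `j ≤ e`, so
`d ≤ e`. -/
theorem covBy_of_isJoin {c a b d : D} (hca : c ⋖ a) (hcb : c ⋖ b) (hab : a ≠ b)
    (hd : IsJoin a b d) : a ⋖ d := by
  have hD := hW.isDomainOrder
  refine ⟨hd.left.lt_of_ne ?_, fun e hae hed => ?_⟩
  · rintro rfl
    exact hca.2 hcb.lt (hd.right.lt_of_ne' hab)
  obtain ⟨i, p, hi, hp, hpc, hic, hji⟩ := hD.exists_irreducible_of_covBy hca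
  obtain ⟨j, p', hj, hp', hpc', hjc, hjj⟩ := hD.exists_irreducible_of_covBy hcb
  obtain ⟨k, hke, hk, hka, hlt⟩ := hD.exists_irreducible hae.not_ge
  obtain ⟨r, hr⟩ := hD.exists_isPred hk
  have hra := hlt r hr.1
  obtain ⟨l, q, hkl, hq, hl⟩ := hW.exists_interchangeable hji hjj hd hk (hke.trans hed.le)
  have hla : ¬ l ≤ a := fun hla => hka <|
    hkl.symm.le_of_le hq hr (hq.1.le.trans hla) hra ⟨e, hke, hae.le⟩ le_rfl hla
  have hlj : l ≤ j := (hl.resolve_left fun h => hla (h.trans hji.left)).resolve_left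
    fun h => hla (h.trans hji.right)
  obtain rfl : l = j := hlj.eq_or_lt.resolve_right fun h =>
    hla (((hp'.2 l h).trans hpc').trans hji.left)
  have hle : l ≤ e := hkl.le_of_le hr hq hra ((hp'.2 q hq.1).trans (hpc'.trans hji.left))
    ⟨d, hjj.right.trans hd.right, hd.left⟩ hae.le hke
  exact hed.not_ge (hd.le hae.le (hjj.le (hca.le.trans hae.le) hle))

theorem eq_of_covBy {c a b b' d : D} (hca : c ⋖ a) (hcb : c ⋖ b) (hcb' : c ⋖ b')
    (hab : a ≠ b) (hab' : a ≠ b') (had : a ⋖ d) (hbd : b ≤ d) (hbd' : b' ≤ d) : b = b' := by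
  have hD := hW.isDomainOrder
  have hcov : ∀ {x y : D}, c ⋖ x → c ⋖ y → x ≤ y → x = y := fun hx hy h =>
    h.eq_or_lt.resolve_right (hy.2 hx.lt)
  obtain ⟨z, hz⟩ := hD.exists_isJoin ⟨d, had.le, hbd⟩
  have haz : a < z := hz.left.lt_of_ne (by rintro rfl; exact hab (hcov hcb hca hz.right).symm)
  obtain rfl : z = d := (hz.le had.le hbd).eq_or_lt.resolve_right (had.2 haz)
  obtain ⟨i, p, hi, hp, hpc, hic, hji⟩ := hD.exists_irreducible_of_covBy hca
  obtain ⟨j, p', hj, hp', hpc', hjc, hjj⟩ := hD.exists_irreducible_of_covBy hcb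
  obtain ⟨k, r, hk, hr, hrc, hkc, hjk⟩ := hD.exists_irreducible_of_covBy hcb'
  obtain ⟨l, q, hkl, hq, hl⟩ := hW.exists_interchangeable hji hjj hz hk (hjk.right.trans hbd')
  -- The irreducible `k` inducing `b'` is interchangeable with `l`, so any `t ≥ c` containing `l`
  -- contains `b'`. Taking `t` to be `c`, `a` or `b` settles the three positions of `l`.
  have key : ∀ t, q ≤ c → c ≤ t → l ≤ t → b' ≤ t := fun t hqc hct hlt =>
    hjk.le hct (hkl.symm.le_of_le hq hr hqc hrc ⟨b', hjk.right, hjk.left⟩ hct hlt)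
  rcases hl with hl | hl | hl
  · exact absurd (key c (hq.1.le.trans hl) le_rfl hl) hcb'.lt.not_ge
  · have := key a ((hp.2 q (hq.1.trans_le hl)).trans hpc) hca.le (hl.trans hji.right)
    exact absurd (hcov hcb' hca this).symm hab'
  · have := key b ((hp'.2 q (hq.1.trans_le hl)).trans hpc') hcb.le (hl.trans hjj.right)
    exact (hcov hcb' hcb this).symm

theorem isFusionOrder : IsFusionOrder {x : D // IsCompactElement x} := by
  have hD := hW.isDomainOrder
  have cov : ∀ {x y : {x : D // IsCompactElement x}}, x ⋖ y ↔ x.1 ⋖ y.1 := by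
    intro x y
    refine ⟨fun h => ⟨h.lt, fun z hxz hzy => ?_⟩, fun h => ⟨h.lt, fun z hxz hzy => h.2 hxz hzy⟩⟩
    exact h.2 (c := ⟨z, hD.isCompactElement_of_le y.2 hzy.le⟩) hxz hzy
  have comp : ∀ {x y : {x : D // IsCompactElement x}}, Compatible x y → Compatible x.1 y.1 :=
    fun ⟨t, h1, h2⟩ => ⟨t.1, h1, h2⟩
  have lub : ∀ {X : Set {x : D // IsCompactElement x}}, X.Finite →
      (∀ x ∈ X, ∀ y ∈ X, Compatible x y) → ∃ t, ∀ x ∈ X, x ≤ t := by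
    intro X hX h
    obtain ⟨t, ht⟩ := hD.coherent (Subtype.val '' X) (by
      rintro _ ⟨x, hx, rfl⟩ _ ⟨y, hy, rfl⟩
      exact Compatible.bddAbove_iff.2 (comp (h x hx y hy)))
    refine ⟨⟨t, IsDomainOrder.isCompactElement_isLUB (hX.image _) ?_ ht⟩, fun x hx => ht.1 ⟨x, hx, rfl⟩⟩
    rintro _ ⟨x, -, rfl⟩
    exact x.2
  refine ⟨?_, ?_, ?_, ?_, ?_⟩
  · obtain ⟨b, hb⟩ := hD.coherent ∅ (by simp [PairwiseConsistent])
    exact ⟨⟨b, IsDomainOrder.isCompactElement_isLUB Set.finite_empty (by simp) hb⟩,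
      fun x => hb.2 (by simp)⟩
  · exact fun x => (hD.finitary x.1 x.2).preimage Subtype.val_injective.injOn
  · intro c a b hca hcb hab hc
    obtain ⟨t, hat, hbt⟩ := hc
    obtain ⟨d, hd⟩ := hD.exists_isJoin ⟨t.1, hat, hbt⟩
    have hab' : a.1 ≠ b.1 := fun h => hab (Subtype.ext h)
    exact ⟨⟨d, hD.isCompactElement_of_le t.2 (hd.le hat hbt)⟩,
      cov.2 (hW.covBy_of_isJoin (cov.1 hca) (cov.1 hcb) hab' hd),
      cov.2 (hW.covBy_of_isJoin (cov.1 hcb) (cov.1 hca) hab'.symm hd.symm), fun t => hd t.1⟩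
  · intro c a b b' d hca hcb hcb' hab hab' had hbd hbd'
    exact Subtype.ext <| hW.eq_of_covBy (cov.1 hca) (cov.1 hcb) (cov.1 hcb')
      (fun h => hab (Subtype.ext h)) (fun h => hab' (Subtype.ext h)) (cov.1 had) hbd hbd'
  · intro c a b e _ _ _ hab hbe hae
    obtain ⟨t, ht⟩ := lub (X := {a, b, e}) (by simp) (by
      have self : ∀ x : {x : D // IsCompactElement x}, Compatible x x :=
        fun x => Compatible.of_le le_rfl
      rintro x (rfl | rfl | rfl) y (rfl | rfl | rfl)
      exacts [self _, hab, hae, hab.symm, self _, hbe, hae.symm, hbe.symm, self _])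
    exact ⟨t, ht a (by simp), ht b (by simp), ht e (by simp)⟩

end IsWeakPrimeDomain

end WeakPrimeDom

/-! ### The covering graph of a fusion order and its path classes. -/

/-- The graph of the covering relation of an order, with all squares commuting. -/
def coverGraph {P : Type*} [PartialOrder P] (b : P) :
    PointedSquareGraph P {e : P × P // e.1 ⋖ e.2} where
  s e := e.1.1
  t e := e.1.2
  n₀ := b
  sim p q := p.1.1.2 = p.2.1.1 ∧ q.1.1.2 = q.2.1.1 ∧ p.1.1.1 = q.1.1.1 ∧ p.2.1.2 = q.2.1.2

theorem coverGraph_le_target {P : Type*} [PartialOrder P] {n b : P} :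
    ∀ {w : List {e : P × P // e.1 ⋖ e.2}},
    (coverGraph b).IsPathFrom n w → n ≤ (coverGraph b).target n w := by
  intro w
  induction w generalizing n with
  | nil => exact fun _ => le_rfl
  | cons u w ih =>
    rintro ⟨rfl, h⟩
    exact u.2.le.trans (ih h)

namespace IsFusionOrder

variable {P : Type*} [PartialOrder P] (hP : IsFusionOrder P)
include hP

theorem isJoin_of_covBy {c a b d : P} (hca : c ⋖ a) (hcb : c ⋖ b) (hab : a ≠ b) (had : a ⋖ d)
    (hbd : b ≤ d) : IsJoin a b d := by
  obtain ⟨d', had', -, hd'⟩ := hP.square hca hcb hab ⟨d, had.le, hbd⟩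
  obtain rfl : d' = d := (hd'.le had.le hbd).eq_or_lt.resolve_right (had.2 had'.lt)
  exact hd'

/-- Both `d₁ ∨ d₂` and `d₁ ∨ d₃` are the join of `a`, `b`, `e`, so the two upper squares end at the
same vertex. -/
theorem exists_cube {c a b e d₁ d₂ d₃ t : P} (hca : c ⋖ a) (hcb : c ⋖ b)
    (hab : a ≠ b) (h₁ : a ⋖ d₁) (hb₁ : b ⋖ d₁) (h₂ : a ⋖ d₂) (h₃ : b ⋖ d₃) (h₁₂ : d₁ ≠ d₂)
    (h₁₃ : d₁ ≠ d₃) (ht₂ : IsJoin a e d₂) (ht₃ : IsJoin b e d₃) (hat : a ≤ t)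
    (hbt : b ≤ t) (het : e ≤ t) : ∃ r, d₁ ⋖ r ∧ d₂ ⋖ r ∧ d₃ ⋖ r ∧ r ≤ t := by
  have hj := hP.isJoin_of_covBy hca hcb hab h₁ hb₁.le
  obtain ⟨r, h1, h2, hr⟩ := hP.square h₁ h₂ h₁₂ ⟨t, hj.le hat hbt, ht₂.le hat het⟩
  obtain ⟨r', h1', h3, hr'⟩ := hP.square hb₁ h₃ h₁₃ ⟨t, hj.le hat hbt, ht₃.le hbt het⟩
  obtain rfl : r = r' := le_antisymm
    (hr.le h1'.le (ht₂.le (h₁.le.trans h1'.le) (ht₃.right.trans h3.le)))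
    (hr'.le h1.le (ht₃.le (hb₁.le.trans h1.le) (ht₂.right.trans h2.le)))
  exact ⟨r, h1, h2, h3, hr.le (hj.le hat hbt) (ht₂.le hat het)⟩

/-- The covering graph of a fusion order is a weak asynchronous graph. -/
def weakAsyncGraph (b : P) : WeakAsyncGraph P {e : P × P // e.1 ⋖ e.2} where
  __ := coverGraph b
  sim_path _ _ h := ⟨h.1, h.2.1⟩
  sim_coinitial _ _ h := h.2.2.1
  sim_cofinal _ _ h := h.2.2.2
  sim_refl _ h := ⟨h, h, rfl, rfl⟩
  sim_symm _ _ h := ⟨h.2.1, h.1, h.2.2.1.symm, h.2.2.2.symm⟩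
  sim_trans _ _ _ h h' := ⟨h.1, h'.2.1, h.2.2.1.trans h'.2.2.1, h.2.2.2.trans h'.2.2.2⟩
  determinism := by
    rintro u₁ u₂ v₁ v₂ ⟨h1, h2, h3, h4⟩ hne rfl
    exact hne (Subtype.ext (Prod.ext (h1.symm.trans h2) h4))
  closing := by
    rintro ⟨⟨c, a⟩, hca⟩ ⟨⟨_, d⟩, had⟩ ⟨⟨_, b⟩, hcb⟩ ⟨⟨_, _⟩, hbd⟩ ⟨⟨_, d'⟩, had'⟩ ⟨⟨_, b'⟩, hcb'⟩
      ⟨⟨_, _⟩, hbd'⟩ ⟨⟨h1, h2, h3, h4⟩, hne⟩ ⟨⟨h1', h2', h3', h4'⟩, hne'⟩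
    dsimp only at *
    subst h1 h2 h3 h4 h1' h2' h3' h4'
    simp only [ne_eq, Subtype.mk.injEq, Prod.mk.injEq, true_and] at hne hne' ⊢
    constructor
    · rintro rfl
      exact hP.eq_of_covBy hca hcb hcb' hne hne' had hbd.le hbd'.le
    · rintro rfl
      exact (hP.isJoin_of_covBy hca hcb hne had hbd.le).unique
        (hP.isJoin_of_covBy hca hcb hne had' hbd'.le)
  cube := by
    rintro ⟨⟨c, a⟩, hca⟩ ⟨⟨_, d₂⟩, h₂⟩ ⟨⟨_, t⟩, h₂t⟩ ⟨⟨_, b⟩, hcb⟩ ⟨⟨_, d₃⟩, h₃⟩ ⟨⟨_, _⟩, h₃t⟩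
      ⟨⟨_, e⟩, hce⟩ ⟨⟨_, _⟩, he₂⟩ ⟨⟨_, _⟩, he₃⟩ ⟨⟨h1, h2, h3, h4⟩, hne⟩ ⟨⟨h1', h2', h3', h4'⟩, hne'⟩
      ⟨⟨h1'', h2'', h3'', h4''⟩, hne''⟩
    dsimp only at *
    subst h1 h2 h3 h4 h1' h2' h3' h4' h1'' h2'' h4''
    simp only [ne_eq, Subtype.mk.injEq, Prod.mk.injEq, true_and] at hne hne' hne''
    have J₂ := hP.isJoin_of_covBy hca hce hne h₂ he₂.le
    have J₃ := hP.isJoin_of_covBy hcb hce hne' h₃ he₃.le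
    -- Otherwise `d₂` and `d₃` would both be `a ∨ e`, making the third square degenerate.
    have hab : a ≠ b := by
      rintro rfl
      exact hne'' (J₂.unique J₃)
    have hat := h₂.le.trans h₂t.le
    have hbt := h₃.le.trans h₃t.le
    obtain ⟨d₁, h₁, hb₁, J₁⟩ := hP.square hca hcb hab ⟨t, hat, hbt⟩
    -- Equality would put `b ∨ e = d₃` strictly below `d₂ < t`, against `d₃ ⋖ t`.
    have h₁₂ : d₁ ≠ d₂ := by
      rintro rfl
      exact h₃t.2 ((J₃.le J₁.right J₂.right).lt_of_ne (Ne.symm hne'')) h₂t.lt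
    have h₁₃ : d₁ ≠ d₃ := by
      rintro rfl
      exact h₂t.2 ((J₂.le J₁.left J₃.right).lt_of_ne hne'') h₃t.lt
    obtain ⟨r, h₁r, h₂r, -, hrt⟩ := hP.exists_cube hca hcb hab h₁ hb₁ h₂ h₃ h₁₂ h₁₃ J₂ J₃ hat hbt
      (he₂.le.trans h₂t.le)
    obtain rfl : r = t := hrt.eq_or_lt.resolve_right (h₂t.2 h₂r.lt)
    refine ⟨⟨(a, d₁), h₁⟩, ⟨(b, d₁), hb₁⟩, ⟨(d₁, r), h₁r⟩, ⟨⟨rfl, rfl, rfl, rfl⟩, ?_⟩,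
      ⟨⟨rfl, rfl, rfl, rfl⟩, ?_⟩, ⟨⟨rfl, rfl, rfl, rfl⟩, ?_⟩⟩
    · simpa using hab
    · simpa using h₁₂.symm
    · simpa using h₁₃.symm
  coherence := by
    rintro ⟨⟨c, a⟩, hca⟩ ⟨⟨_, d₂⟩, h₂⟩ ⟨⟨_, b⟩, hcb⟩ ⟨⟨_, d₃⟩, h₃⟩ ⟨⟨_, e⟩, hce⟩ ⟨⟨_, _⟩, he₂⟩
      ⟨⟨_, _⟩, he₃⟩ ⟨⟨_, d₁⟩, h₁⟩ ⟨⟨_, _⟩, hb₁⟩ ⟨⟨h1, h2, h3, h4⟩, hne⟩ ⟨⟨h1', h2', h3', h4'⟩, hne'⟩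
      ⟨⟨h1'', h2'', h3'', h4''⟩, hne''⟩
    dsimp only at *
    subst h1 h2 h3 h4 h1' h2' h3' h4' h1'' h2'' h4''
    simp only [ne_eq, Subtype.mk.injEq, Prod.mk.injEq, true_and] at hne hne' hne''
    have J₂ := hP.isJoin_of_covBy hca hce hne h₂ he₂.le
    have J₃ := hP.isJoin_of_covBy hcb hce hne' h₃ he₃.le
    have h₁₂ : d₁ ≠ d₂ := by
      rintro rfl
      exact hne' (hP.eq_of_covBy hca hcb hce hne'' hne h₁ hb₁.le he₂.le)
    have h₁₃ : d₁ ≠ d₃ := by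
      rintro rfl
      exact hne (hP.eq_of_covBy hcb hca hce (Ne.symm hne'') hne' hb₁ h₁.le he₃.le)
    obtain ⟨t, hat, hbt, het⟩ := hP.triple hca hcb hce ⟨d₁, h₁.le, hb₁.le⟩ ⟨d₃, h₃.le, he₃.le⟩
      ⟨d₂, h₂.le, he₂.le⟩
    obtain ⟨r, h₁r, h₂r, h₃r, -⟩ := hP.exists_cube hca hcb hne'' h₁ hb₁ h₂ h₃ h₁₂ h₁₃ J₂ J₃ hat hbt
      het
    refine ⟨⟨(d₂, r), h₂r⟩, ⟨(d₃, r), h₃r⟩, ⟨(d₁, r), h₁r⟩, ⟨⟨rfl, rfl, rfl, rfl⟩, ?_⟩,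
      ⟨⟨rfl, rfl, rfl, rfl⟩, ?_⟩⟩
    · simpa using h₁₂.symm
    · simpa using h₁₃.symm

theorem exists_path {b s : P} : ∀ n ≤ s, ∃ w, (coverGraph b).IsPathFrom n w ∧
    (coverGraph b).target n w = s := by
  refine hP.induction_down fun n hn ih => ?_
  rcases hn.eq_or_lt with rfl | hn
  · exact ⟨[], trivial, rfl⟩
  obtain ⟨a, hna, has⟩ := hP.exists_covBy hn
  obtain ⟨w, hw, rfl⟩ := ih a hna.lt has
  exact ⟨⟨(n, a), hna⟩ :: w, ⟨rfl, hw⟩, rfl⟩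

end IsFusionOrder

namespace PointedSquareGraph

variable {N U : Type*} (G : PointedSquareGraph N U)

theorem PathEquiv.cons {G : PointedSquareGraph N U} {x y : List U} (u : U)
    (h : G.PathEquiv x y) : G.PathEquiv (u :: x) (u :: y) := by
  induction h with
  | rel _ _ h =>
    obtain ⟨w₁, w₂, u₁, u₂, v₁, v₂, h⟩ := h
    exact .rel _ _ (Step.mk (u :: w₁) w₂ u₁ u₂ v₁ v₂ h)
  | refl => exact .refl _
  | symm _ _ _ ih => exact .symm _ _ ih
  | trans _ _ _ _ _ ih ih' => exact .trans _ _ _ ih ih'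

theorem pathEquiv_of_sim {u₁ u₂ v₁ v₂ : U} (h : G.sim (u₁, u₂) (v₁, v₂)) (x : List U) :
    G.PathEquiv (u₁ :: u₂ :: x) (v₁ :: v₂ :: x) :=
  .rel _ _ (Step.mk [] x u₁ u₂ v₁ v₂ h)

theorem isPathFrom_append {n : N} {w x : List U} :
    G.IsPathFrom n (w ++ x) ↔ G.IsPathFrom n w ∧ G.IsPathFrom (G.target n w) x := by
  induction w generalizing n with
  | nil => simp [IsPathFrom, target]
  | cons u w ih => simp [IsPathFrom, target, ih, and_assoc]

theorem target_append {n : N} {w x : List U} :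
    G.target n (w ++ x) = G.target (G.target n w) x := by
  induction w generalizing n with
  | nil => rfl
  | cons u w ih => simp [target, ih]

end PointedSquareGraph

theorem WeakAsyncGraph.target_eq_of_pathEquiv {N U : Type*} (A : WeakAsyncGraph N U)
    {w w' : List U} (h : A.PathEquiv w w') (n : N) (hw : A.IsPathFrom n w) :
    A.target n w = A.target n w' := by
  induction h with
  | rel _ _ h =>
    obtain ⟨w₁, w₂, u₁, u₂, v₁, v₂, h⟩ := h
    simp [A.target_append, PointedSquareGraph.target, A.sim_cofinal _ _ h]
  | refl => rfl
  | symm x y h ih => exact (ih ((A.isPathFrom_equiv h n).2 hw)).symm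
  | trans x y z h _ ih ih' => exact (ih hw).trans (ih' ((A.isPathFrom_equiv h n).1 hw))

namespace IsFusionOrder

variable {P : Type*} [PartialOrder P] (hP : IsFusionOrder P)
include hP

/-- When the first edges differ, the common target bounds their endpoints, so they span a square
with top `d`. Both paths are rerouted through `d` along one common continuation `z`. -/
theorem pathEquiv_of_target_eq {b : P} {w w' : List {e : P × P // e.1 ⋖ e.2}} {n : P}
    (hw : (coverGraph b).IsPathFrom n w) (hw' : (coverGraph b).IsPathFrom n w')
    (h : (coverGraph b).target n w = (coverGraph b).target n w') :
    (coverGraph b).PathEquiv w w' := by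
  induction hl : w.length generalizing w w' n with
  | zero =>
    obtain rfl := List.length_eq_zero_iff.1 hl
    cases w' with
    | nil => exact .refl _
    | cons v y =>
      obtain ⟨rfl, hy⟩ := hw'
      have : v.1.2 ≤ v.1.1 := (coverGraph_le_target hy).trans_eq h.symm
      exact absurd this v.2.lt.not_ge
  | succ k ih =>
    cases w with
    | nil => simp at hl
    | cons u x =>
    cases w' with
    | nil =>
      obtain ⟨rfl, hx⟩ := hw
      have : u.1.2 ≤ u.1.1 := (coverGraph_le_target hx).trans_eq h
      exact absurd this u.2.lt.not_ge
    | cons v y =>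
      have hx : x.length = k := by simpa using hl
      obtain ⟨⟨c, a⟩, hca⟩ := u
      obtain ⟨⟨c', e⟩, hce⟩ := v
      obtain ⟨rfl, hw⟩ := hw
      obtain ⟨h1, hw'⟩ := hw'
      change c' = c at h1
      subst h1
      change (coverGraph b).IsPathFrom a x at hw
      change (coverGraph b).IsPathFrom e y at hw'
      change (coverGraph b).target a x = (coverGraph b).target e y at h
      by_cases hae : a = e
      · subst hae
        exact (ih hw hw' h hx).cons _
      obtain ⟨d, had, hed, hd⟩ := hP.square hca hce hae
        ⟨_, coverGraph_le_target hw, h.ge.trans' (coverGraph_le_target hw')⟩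
      obtain ⟨z, hz, hzt⟩ := hP.exists_path (b := b) d (hd.le (coverGraph_le_target hw) (h.ge.trans' (coverGraph_le_target hw')))
      have e1 : (coverGraph b).PathEquiv x (⟨(a, d), had⟩ :: z) := ih hw ⟨rfl, hz⟩ hzt.symm hx
      -- The induction is on the length of the first path, so applying it to the rerouted second
      -- path requires the length of `z`.
      have hz' : z.length + 1 = k := by
        rw [← hx, (hP.weakAsyncGraph b).length_eq_of_pathEquiv e1]
        rfl
      have e2 : (coverGraph b).PathEquiv (⟨(e, d), hed⟩ :: z) y :=
        ih (n := e) ⟨rfl, hz⟩ hw' (hzt.trans h) (by simpa using hz')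
      have e3 : (coverGraph b).PathEquiv (⟨(c', a), hca⟩ :: ⟨(a, d), had⟩ :: z)
          (⟨(c', e), hce⟩ :: ⟨(e, d), hed⟩ :: z) :=
        (coverGraph b).pathEquiv_of_sim (by exact ⟨rfl, rfl, rfl, rfl⟩) z
      exact .trans _ _ _ (e1.cons _) (.trans _ _ _ e3 (e2.cons _))

end IsFusionOrder

open Order

namespace WeakAsyncGraph

variable {N U : Type*} (A : WeakAsyncGraph N U)

theorem cls_eq_iff {w w' : A.OriginPath} : A.cls w = A.cls w' ↔ A.PathEquiv w.1 w'.1 :=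
  ⟨fun h => Quotient.exact h, fun h => Quotient.sound h⟩

theorem exists_cls (c : A.PathClass) : ∃ w, A.cls w = c := Quotient.exists_rep c

theorem cls_le_iff {w w' : A.OriginPath} :
    A.cls w ≤ A.cls w' ↔ ∃ x, A.PathEquiv w'.1 (w.1 ++ x) := by
  constructor
  · rintro ⟨v, v', h, h', x, hx⟩
    rw [A.cls_eq_iff] at h h'
    refine ⟨x, .trans _ _ _ (.symm _ _ h') ?_⟩
    rw [← hx]
    exact A.pathEquiv_append h x
  · rintro ⟨x, hx⟩
    exact ⟨w, ⟨w.1 ++ x, (A.isPathFrom_equiv hx _).1 w'.2⟩, rfl, A.cls_eq_iff.2 (.symm _ _ hx),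
      List.prefix_append _ _⟩

end WeakAsyncGraph

namespace IsFusionOrder

variable {P : Type*} [PartialOrder P] (hP : IsFusionOrder P)
include hP

theorem isWeakPrime_weakAsyncGraph (b : P) : (hP.weakAsyncGraph b).IsWeakPrime :=
  fun _ _ hw hw' h => hP.pathEquiv_of_target_eq hw hw' h

theorem nonempty_pathClass_orderIso {b : P} (hb : ∀ x, b ≤ x) :
    Nonempty ((hP.weakAsyncGraph b).PathClass ≃o P) := by
  let A := hP.weakAsyncGraph b
  let f : A.PathClass → P := Quotient.lift (fun w => A.target A.n₀ w.1)
    fun w w' h => A.target_eq_of_pathEquiv h _ w.2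
  have hf : ∀ w, f (A.cls w) = A.target b w.1 := fun _ => rfl
  refine ⟨RelIso.ofSurjective (OrderEmbedding.ofMapLEIff f ?_) ?_⟩
  · intro c c'
    obtain ⟨w, rfl⟩ := A.exists_cls c
    obtain ⟨w', rfl⟩ := A.exists_cls c'
    rw [A.cls_le_iff, hf, hf]
    constructor
    · intro h
      obtain ⟨x, hx, hxt⟩ := hP.exists_path (b := b) _ h
      refine ⟨x, hP.pathEquiv_of_target_eq w'.2 ((coverGraph b).isPathFrom_append.2 ⟨w.2, hx⟩) ?_⟩
      exact ((coverGraph b).target_append.trans hxt).symm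
    · rintro ⟨x, hx⟩
      rw [A.target_eq_of_pathEquiv hx b w'.2, A.target_append]
      exact coverGraph_le_target
        ((coverGraph b).isPathFrom_append.1 ((A.isPathFrom_equiv hx b).1 w'.2)).2
  · intro s
    obtain ⟨w, hw, hwt⟩ := hP.exists_path (b := b) b (hb s)
    exact ⟨A.cls ⟨w, hw⟩, hwt⟩

end IsFusionOrder

/-- A domain is the ideal completion of its compact elements. -/
theorem WeakPrimeDom.IsDomainOrder.nonempty_orderIso_ideal {D : Type*} [PartialOrder D]
    (hD : IsDomainOrder D) {Q : Type*} [PartialOrder Q]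
    (e : Q ≃o {x : D // IsCompactElement x}) : Nonempty (D ≃o Ideal Q) := by
  have hI : ∀ d : D, IsIdeal {c : Q | (e c).1 ≤ d} := by
    intro d
    refine ⟨fun x y hyx hx => le_trans (b := (e x).1) (e.monotone hyx) hx, ?_, ?_⟩
    · obtain ⟨b, hb⟩ := hD.coherent ∅ (by simp [PairwiseConsistent])
      refine ⟨e.symm ⟨b, IsDomainOrder.isCompactElement_isLUB Set.finite_empty (by simp) hb⟩, ?_⟩
      simpa using hb.2 (by simp)
    · intro x hx y hy
      obtain ⟨s, hs⟩ := hD.exists_isLUB (X := {(e x).1, (e y).1}) ⟨d, by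
        rintro _ (rfl | rfl)
        exacts [hx, hy]⟩
      have hsc : IsCompactElement s := IsDomainOrder.isCompactElement_isLUB (by simp) (by
        rintro _ (rfl | rfl)
        exacts [(e x).2, (e y).2]) hs
      refine ⟨e.symm ⟨s, hsc⟩, ?_, ?_, ?_⟩
      · simpa using hs.2 (by rintro _ (rfl | rfl); exacts [hx, hy])
      · exact (e.le_symm_apply).2 (hs.1 (.inl rfl))
      · exact (e.le_symm_apply).2 (hs.1 (.inr rfl))
  refine ⟨RelIso.ofSurjective (OrderEmbedding.ofMapLEIff (fun d => (hI d).toIdeal) ?_) ?_⟩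
  · intro d d'
    refine ⟨fun h => hD.le_of_forall_compact fun c hc hcd => ?_, fun h c hc => hc.trans h⟩
    have : e.symm ⟨c, hc⟩ ∈ (hI d').toIdeal := h (by simpa using hcd)
    simpa using this
  · intro I
    -- The preimage of `I` is the supremum of its compact elements: compactness puts any compact
    -- element below that supremum back into `I`.
    have hdir : DirectedOn (· ≤ ·) ((fun c => (e c).1) '' (I : Set Q)) := by
      rintro _ ⟨x, hx, rfl⟩ _ ⟨y, hy, rfl⟩
      obtain ⟨z, hz, h1, h2⟩ := I.directed x hx y hy
      exact ⟨_, ⟨z, hz, rfl⟩, e.monotone h1, e.monotone h2⟩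
    obtain ⟨s, hs⟩ := hD.coherent _ fun x hx y hy =>
      Compatible.bddAbove_iff.2 ((hdir x hx y hy).imp fun _ h => h.2)
    refine ⟨s, ?_⟩
    ext c
    constructor
    · intro hc
      obtain ⟨_, ⟨z, hz, rfl⟩, hcz⟩ := (e c).2 _ s (I.nonempty.image _) hdir hs hc
      exact I.lower (e.le_iff_le.1 hcz) hz
    · exact fun hc => hs.1 ⟨c, hc, rfl⟩

/-! ### The path classes of a weak asynchronous graph form a fusion order. -/

namespace WeakAsyncGraph

variable {N U : Type*} (A : WeakAsyncGraph N U)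

variable {A} in
theorem square_symm {u₁ u₂ v₁ v₂ : U} (h : A.Square u₁ u₂ v₁ v₂) : A.Square v₁ v₂ u₁ u₂ :=
  ⟨A.sim_symm _ _ h.1, h.2.symm⟩

variable {A} in
theorem snd_eq_of_sim {u u₂ v₂ : U} (h : A.sim (u, u₂) (u, v₂)) : u₂ = v₂ := by
  by_contra hne
  exact A.determinism _ _ _ _ h hne rfl

variable {A} in
theorem pathEquiv_of_square {u₁ u₂ v₁ v₂ : U} (h : A.Square u₁ u₂ v₁ v₂) (x : List U) :
    A.PathEquiv (u₁ :: u₂ :: x) (v₁ :: v₂ :: x) :=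
  A.pathEquiv_of_sim h.1 x

/-- Two equivalent non-empty paths either have the same first edge and equivalent remainders, or
their first edges span a square through which both factor. -/
def HeadEquiv (u : U) (x : List U) (v : U) (y : List U) : Prop :=
  (u = v ∧ A.PathEquiv x y) ∨
    ∃ u' v' z, A.Square u u' v v' ∧ A.PathEquiv x (u' :: z) ∧ A.PathEquiv y (v' :: z)

variable {A} in
theorem HeadEquiv.symm {u v : U} {x y : List U} (h : A.HeadEquiv u x v y) :
    A.HeadEquiv v y u x := by
  rcases h with ⟨rfl, h⟩ | ⟨u', v', z, h, hx, hy⟩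
  · exact .inl ⟨rfl, .symm _ _ h⟩
  · exact .inr ⟨v', u', z, square_symm h, hy, hx⟩

/-- In the main case two squares share the edge `v`, and their second edges start paths equivalent
to `y`. These are compared by the hypothesis for shorter paths: equal heads identify `u` with `w` by
`closing`, and a square between them yields one between `u` and `w` by `cube`. -/
theorem headEquiv_trans {u v w : U} {x y z : List U}
    (ih : ∀ {u v : U} {x' y' : List U}, (u :: x').length ≤ y.length →
      A.PathEquiv (u :: x') (v :: y') → A.HeadEquiv u x' v y')
    (h : A.HeadEquiv u x v y) (h' : A.HeadEquiv v y w z) : A.HeadEquiv u x w z := by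
  rcases h with ⟨rfl, h⟩ | ⟨u', f', a, hs, hx, hy⟩
  · rcases h' with ⟨rfl, h'⟩ | ⟨u', v', a, hs, hx, hy⟩
    · exact .inl ⟨rfl, .trans _ _ _ h h'⟩
    · exact .inr ⟨u', v', a, hs, .trans _ _ _ h hx, hy⟩
  rcases h' with ⟨rfl, h'⟩ | ⟨f'', w', b, hs', hy', hz⟩
  · exact .inr ⟨u', f', a, hs, hx, .trans _ _ _ (.symm _ _ h') hy⟩
  have hab : A.PathEquiv (f' :: a) (f'' :: b) := .trans _ _ _ (.symm _ _ hy) hy'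
  rcases ih (A.length_eq_of_pathEquiv hy).ge hab with ⟨rfl, hab'⟩ | ⟨h, k, t, hs'', ha, hb⟩
  · obtain rfl : u = w := (A.closing _ _ _ _ _ _ _ (square_symm hs) hs').1 rfl
    obtain rfl : u' = w' := snd_eq_of_sim (A.sim_trans _ _ _ hs.1 hs'.1)
    exact .inl ⟨rfl, .trans _ _ _ hx (.trans _ _ _ (hab'.cons u') (.symm _ _ hz))⟩
  · obtain ⟨p, q, r, h1, h2, h3⟩ := A.cube _ _ _ _ _ _ _ _ _ hs (square_symm hs') hs''
    refine .inr ⟨p, q, r :: t, h1, ?_, ?_⟩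
    · exact .trans _ _ _ hx (.trans _ _ _ (ha.cons u') (pathEquiv_of_square h2 t))
    · exact .trans _ _ _ hz (.trans _ _ _ (hb.cons w') (pathEquiv_of_square h3 t))

/-- An outer induction on length supplies the shorter comparisons needed by `headEquiv_trans`; an
inner one follows the derivation of the equivalence. -/
theorem headEquiv_of_pathEquiv {u v : U} {x y : List U} (h : A.PathEquiv (u :: x) (v :: y)) :
    A.HeadEquiv u x v y := by
  induction hn : x.length using Nat.strong_induction_on generalizing u v x y with
  | _ n ih =>
  subst hn
  generalize hp : u :: x = p at h
  generalize hq : v :: y = q at h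
  induction h generalizing u v x y with
  | rel _ _ h =>
    obtain ⟨w₁, w₂, u₁, u₂, v₁, v₂, h⟩ := h
    cases w₁ with
    | nil =>
      obtain ⟨rfl, rfl⟩ := List.cons.inj hp
      obtain ⟨rfl, rfl⟩ := List.cons.inj hq
      by_cases huv : u = v
      · subst huv
        obtain rfl := snd_eq_of_sim h
        exact .inl ⟨rfl, .refl _⟩
      · exact .inr ⟨u₂, v₂, w₂, ⟨h, huv⟩, .refl _, .refl _⟩
    | cons c w₁ =>
      obtain ⟨rfl, rfl⟩ := List.cons.inj hp
      obtain ⟨rfl, rfl⟩ := List.cons.inj hq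
      exact .inl ⟨rfl, .rel _ _ (.mk w₁ w₂ _ _ _ _ h)⟩
  | refl =>
    subst hp
    obtain ⟨rfl, rfl⟩ := List.cons.inj hq
    exact .inl ⟨rfl, .refl _⟩
  | symm a b hab ih' =>
    have hl := A.length_eq_of_pathEquiv hab
    subst hp hq
    exact (ih' (fun m hm => ih m (by simp at hl; omega)) rfl rfl).symm
  | trans a b c hab hbc ih₁ ih₂ =>
    have hl := A.length_eq_of_pathEquiv hab
    subst hp hq
    cases b with
    | nil => simp at hl
    | cons w z =>
      have hl : x.length = z.length := by simpa using hl
      refine A.headEquiv_trans (fun {u v x' y'} hlt h => ?_) (ih₁ ih rfl rfl)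
        (ih₂ (fun m hm => ih m (by omega)) rfl rfl)
      simp only [List.length_cons] at hlt
      exact ih x'.length (by omega) h rfl

theorem pathEquiv_of_cons {u : U} {x y : List U} (h : A.PathEquiv (u :: x) (u :: y)) :
    A.PathEquiv x y := by
  rcases A.headEquiv_of_pathEquiv h with ⟨-, h⟩ | ⟨u', v', z, h, -, -⟩
  · exact h
  · exact absurd rfl h.2

theorem pathEquiv_of_append {w x y : List U} (h : A.PathEquiv (w ++ x) (w ++ y)) :
    A.PathEquiv x y := by
  induction w with
  | nil => exact h
  | cons u w ih => exact ih (A.pathEquiv_of_cons h)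

theorem append_pathEquiv (w : List U) {x y : List U} (h : A.PathEquiv x y) :
    A.PathEquiv (w ++ x) (w ++ y) := by
  induction w with
  | nil => exact h
  | cons u w ih => exact ih.cons u

theorem eq_of_pathEquiv_singleton {u v : U} (h : A.PathEquiv [u] [v]) : u = v := by
  rcases A.headEquiv_of_pathEquiv h with ⟨h, -⟩ | ⟨u', v', z, -, h, -⟩
  · exact h
  · simpa using A.length_eq_of_pathEquiv h

/-- A first edge of an equivalent path is `u` or is opposite `u` in a square `u;u'`, where `u'`
begins a path equivalent to the tail. There are finitely many `u'` by induction, and `closing` gives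
one edge for each. For a fixed head, cancellation confines the tails to one class. -/
theorem finite_pathEquiv (w : List U) : {x | A.PathEquiv w x}.Finite := by
  induction hn : w.length generalizing w with
  | zero =>
    obtain rfl := List.length_eq_zero_iff.1 hn
    refine (Set.finite_singleton []).subset fun x hx => ?_
    exact List.length_eq_zero_iff.1 (A.length_eq_of_pathEquiv hx).symm
  | succ n ih =>
    cases w with
    | nil => simp at hn
    | cons u w =>
    have hw : w.length = n := by simpa using hn
    have hheads : {v | ∃ y, A.PathEquiv (u :: w) (v :: y)}.Finite := by
      let T : Set U := {u' | ∃ z, A.PathEquiv w (u' :: z)}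
      have hT : T.Finite := by
        refine ((ih w hw).image fun x => x.head?).preimage
          (f := some) (Option.some_injective U).injOn |>.subset ?_
        rintro u' ⟨z, hz⟩
        exact ⟨_, hz, rfl⟩
      have hT' : {v | ∃ u' ∈ T, ∃ v', A.Square u u' v v'}.Finite := by
        have : {v | ∃ u' ∈ T, ∃ v', A.Square u u' v v'} =
            ⋃ u' ∈ T, {v | ∃ v', A.Square u u' v v'} := by
          ext; simp
        rw [this]
        refine hT.biUnion fun u' _ => Set.Subsingleton.finite ?_
        rintro v ⟨v', hv⟩ t ⟨t', ht⟩
        exact (A.closing _ _ _ _ _ _ _ hv ht).1 rfl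
      refine ((Set.finite_singleton u).union hT').subset ?_
      rintro v ⟨y, hy⟩
      rcases A.headEquiv_of_pathEquiv hy with ⟨h, -⟩ | ⟨u', v', z, h, hz, -⟩
      · exact .inl h.symm
      · exact .inr ⟨u', ⟨z, hz⟩, v', h⟩
    have : {x | A.PathEquiv (u :: w) x} ⊆ ⋃ v ∈ {v | ∃ y, A.PathEquiv (u :: w) (v :: y)},
        List.cons v '' {y | A.PathEquiv (u :: w) (v :: y)} := by
      intro x hx
      cases x with
      | nil => simpa using A.length_eq_of_pathEquiv hx
      | cons v y => exact Set.mem_biUnion ⟨y, hx⟩ ⟨y, hx, rfl⟩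
    refine (hheads.biUnion ?_).subset this
    rintro v ⟨y, hy⟩
    refine Set.Finite.image _ ((ih y ?_).subset fun z hz => ?_)
    · have := A.length_eq_of_pathEquiv hy
      simp only [List.length_cons] at this
      omega
    · exact A.pathEquiv_of_cons (.trans _ _ _ (.symm _ _ hy) hz)

theorem finite_Iic (c : A.PathClass) : (Set.Iic c).Finite := by
  obtain ⟨w, rfl⟩ := A.exists_cls c
  have hf : {x : List U | ∃ y, A.PathEquiv w.1 y ∧ x <+: y}.Finite := by
    have : {x : List U | ∃ y, A.PathEquiv w.1 y ∧ x <+: y} =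
        ⋃ y ∈ {y | A.PathEquiv w.1 y}, {x | x ∈ y.inits} := by
      ext; simp
    rw [this]
    exact (A.finite_pathEquiv w.1).biUnion fun y _ => List.finite_toSet _
  refine ((hf.preimage (f := Subtype.val) (Subtype.val_injective.injOn)).image
    A.cls).subset ?_
  rintro c ⟨v, v', rfl, h, hp⟩
  exact ⟨v, ⟨v'.1, .symm _ _ (A.cls_eq_iff.1 h), hp⟩, rfl⟩

theorem cls_lt_iff {w w' : A.OriginPath} :
    A.cls w < A.cls w' ↔ ∃ u x, A.PathEquiv w'.1 (w.1 ++ u :: x) := by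
  constructor
  · intro h
    obtain ⟨x, hx⟩ := A.cls_le_iff.1 h.le
    cases x with
    | nil =>
      have hx : A.PathEquiv w'.1 w.1 := by simpa using hx
      exact absurd (A.cls_eq_iff.2 hx).symm h.ne
    | cons u x => exact ⟨u, x, hx⟩
  · rintro ⟨u, x, hx⟩
    refine (A.cls_le_iff.2 ⟨_, hx⟩).lt_of_ne fun h => ?_
    have := A.length_eq_of_pathEquiv (.trans _ _ _ (A.cls_eq_iff.1 h) hx)
    simp at this

/-- Equivalent paths have equal length, so the class order is graded by length and no class fits
strictly between. -/
theorem cls_covBy_append (w : A.OriginPath) {u : U} (hu : A.IsPathFrom A.n₀ (w.1 ++ [u])) :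
    A.cls w ⋖ A.cls ⟨w.1 ++ [u], hu⟩ := by
  refine ⟨A.cls_lt_iff.2 ⟨u, [], .refl _⟩, fun c h1 h2 => ?_⟩
  obtain ⟨v, rfl⟩ := A.exists_cls c
  obtain ⟨a, x, hx⟩ := A.cls_lt_iff.1 h1
  obtain ⟨b, y, hy⟩ := A.cls_lt_iff.1 h2
  have l2 := A.length_eq_of_pathEquiv hx
  have l3 := A.length_eq_of_pathEquiv hy
  simp at l2 l3
  omega

theorem exists_of_cls_covBy {w : A.OriginPath} {c : A.PathClass} (h : A.cls w ⋖ c) :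
    ∃ (u : U) (hu : A.IsPathFrom A.n₀ (w.1 ++ [u])), c = A.cls ⟨w.1 ++ [u], hu⟩ := by
  obtain ⟨w', rfl⟩ := A.exists_cls c
  obtain ⟨u, x, hx⟩ := A.cls_lt_iff.1 h.lt
  have hp := (A.isPathFrom_equiv hx A.n₀).1 w'.2
  have hp' : A.IsPathFrom A.n₀ (w.1 ++ [u]) := by
    rw [show w.1 ++ u :: x = (w.1 ++ [u]) ++ x by simp, A.isPathFrom_append] at hp
    exact hp.1
  have h1 : A.cls ⟨w.1 ++ [u], hp'⟩ ≤ A.cls w' := A.cls_le_iff.2 ⟨x, by simpa using hx⟩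
  exact ⟨u, hp', (h1.eq_or_lt.resolve_right (h.2 (A.cls_covBy_append w hp').lt)).symm⟩

theorem cls_append_le_iff {w w' : A.OriginPath} {u : U}
    {hu : A.IsPathFrom A.n₀ (w.1 ++ [u])} :
    A.cls ⟨w.1 ++ [u], hu⟩ ≤ A.cls w' ↔ ∃ x, A.PathEquiv w'.1 (w.1 ++ u :: x) :=
  A.cls_le_iff.trans (by simp)

theorem headEquiv_of_append {t w x y : List U} {u v : U} (h : A.PathEquiv t (w ++ u :: x))
    (h' : A.PathEquiv t (w ++ v :: y)) : A.HeadEquiv u x v y :=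
  A.headEquiv_of_pathEquiv (A.pathEquiv_of_append (.trans _ _ _ (.symm _ _ h) h'))

theorem exists_square {w : A.OriginPath} {u v : U} {hu : A.IsPathFrom A.n₀ (w.1 ++ [u])}
    {hv : A.IsPathFrom A.n₀ (w.1 ++ [v])} (huv : u ≠ v)
    (h : Compatible (A.cls ⟨w.1 ++ [u], hu⟩) (A.cls ⟨w.1 ++ [v], hv⟩)) :
    ∃ u' v', A.Square u u' v v' := by
  obtain ⟨t, h1, h2⟩ := h
  obtain ⟨t, rfl⟩ := A.exists_cls t
  obtain ⟨x, hx⟩ := A.cls_append_le_iff.1 h1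
  obtain ⟨y, hy⟩ := A.cls_append_le_iff.1 h2
  rcases A.headEquiv_of_append hx hy with ⟨h, -⟩ | ⟨u', v', z, h, -, -⟩
  · exact absurd h huv
  · exact ⟨u', v', h⟩

theorem isPathFrom_append_of_square {n : N} {w : List U} {u u' v v' : U}
    (h : A.Square u u' v v') (hu : A.IsPathFrom n (w ++ [u])) :
    A.IsPathFrom n ((w ++ [u]) ++ [u']) := by
  refine A.isPathFrom_append.2 ⟨hu, ?_, trivial⟩
  rw [A.target_append]
  exact (A.sim_path _ _ h.1).1.symm

theorem isFusionOrder_pathClass : IsFusionOrder A.PathClass := by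
  refine ⟨?_, A.finite_Iic, ?_, ?_, ?_⟩
  · refine ⟨A.cls ⟨[], trivial⟩, fun c => ?_⟩
    obtain ⟨w, rfl⟩ := A.exists_cls c
    exact A.cls_le_iff.2 ⟨w.1, .refl _⟩
  · intro c a b hca hcb hab hc
    obtain ⟨w, rfl⟩ := A.exists_cls c
    obtain ⟨u, hu, rfl⟩ := A.exists_of_cls_covBy hca
    obtain ⟨v, hv, rfl⟩ := A.exists_of_cls_covBy hcb
    have huv : u ≠ v := by
      rintro rfl
      exact hab rfl
    obtain ⟨u', v', hs⟩ := A.exists_square huv hc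
    have hu' := A.isPathFrom_append_of_square hs hu
    have hv' := A.isPathFrom_append_of_square (square_symm hs) hv
    have heq : A.cls ⟨(w.1 ++ [u]) ++ [u'], hu'⟩ = A.cls ⟨(w.1 ++ [v]) ++ [v'], hv'⟩ := by
      refine A.cls_eq_iff.2 ?_
      simpa using A.append_pathEquiv w.1 (pathEquiv_of_square hs [])
    have h1 := A.cls_covBy_append ⟨w.1 ++ [u], hu⟩ hu'
    have h2 := A.cls_covBy_append ⟨w.1 ++ [v], hv⟩ hv'
    rw [← heq] at h2
    refine ⟨_, h1, h2, fun t => ⟨fun h => ⟨h1.le.trans h, h2.le.trans h⟩, fun ⟨h3, h4⟩ => ?_⟩⟩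
    obtain ⟨t, rfl⟩ := A.exists_cls t
    obtain ⟨x, hx⟩ := A.cls_append_le_iff.1 h3
    obtain ⟨y, hy⟩ := A.cls_append_le_iff.1 h4
    rcases A.headEquiv_of_append hx hy with ⟨h, -⟩ | ⟨p, q, z, h, hz, -⟩
    · exact absurd h huv
    -- The square through which `t` factors is the chosen one, since `u` and `v` determine `u'`.
    obtain rfl : u' = p := (A.closing _ _ _ _ _ _ _ hs h).2 rfl
    have hz' := A.append_pathEquiv w.1 (hz.cons u)
    have ht : A.PathEquiv t.1 (w.1 ++ u :: u' :: z) := .trans _ _ _ hx hz'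
    exact A.cls_le_iff.2 ⟨z, by simpa using ht⟩
  · intro c a b b' d hca hcb hcb' hab hab' had hbd hbd'
    obtain ⟨w, rfl⟩ := A.exists_cls c
    obtain ⟨u, hu, rfl⟩ := A.exists_of_cls_covBy hca
    obtain ⟨v, hv, rfl⟩ := A.exists_of_cls_covBy hcb
    obtain ⟨v', hv', rfl⟩ := A.exists_of_cls_covBy hcb'
    obtain ⟨g, hg, rfl⟩ := A.exists_of_cls_covBy had
    -- A cover of `w` below `w;u;g` other than `w;u` comes from a square on `u;g`, and `closing`
    -- leaves only one such edge.
    have key : ∀ {v : U} {hv : A.IsPathFrom A.n₀ (w.1 ++ [v])},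
        A.cls ⟨w.1 ++ [u], hu⟩ ≠ A.cls ⟨w.1 ++ [v], hv⟩ →
        A.cls ⟨w.1 ++ [v], hv⟩ ≤ A.cls ⟨(w.1 ++ [u]) ++ [g], hg⟩ → ∃ v', A.Square u g v v' := by
      intro v hv hne hle
      obtain ⟨y, hy⟩ := A.cls_append_le_iff.1 hle
      have hy : A.PathEquiv (w.1 ++ u :: [g]) (w.1 ++ v :: y) := by simpa using hy
      rcases A.headEquiv_of_append (.refl _) hy with ⟨rfl, -⟩ | ⟨p, q, z, h, hz, -⟩
      · exact absurd rfl hne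
      have hz0 : z = [] := by
        have := A.length_eq_of_pathEquiv hz
        simpa using this
      subst hz0
      obtain rfl := A.eq_of_pathEquiv_singleton hz
      exact ⟨q, h⟩
    obtain ⟨q, hq⟩ := key hab hbd
    obtain ⟨q', hq'⟩ := key hab' hbd'
    obtain rfl : v = v' := (A.closing _ _ _ _ _ _ _ hq hq').1 rfl
    rfl
  · intro c a b e hca hcb hce hab hbe hae
    obtain ⟨w, rfl⟩ := A.exists_cls c
    obtain ⟨u, hu, rfl⟩ := A.exists_of_cls_covBy hca
    obtain ⟨v, hv, rfl⟩ := A.exists_of_cls_covBy hcb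
    obtain ⟨f, hf, rfl⟩ := A.exists_of_cls_covBy hce
    by_cases huv : u = v
    · subst huv
      obtain ⟨t, h1, h2⟩ := hae
      exact ⟨t, h1, h1, h2⟩
    by_cases huf : u = f
    · subst huf
      obtain ⟨t, h1, h2⟩ := hab
      exact ⟨t, h1, h2, h1⟩
    by_cases hvf : v = f
    · subst hvf
      obtain ⟨t, h1, h2⟩ := hab
      exact ⟨t, h1, h2, h2⟩
    obtain ⟨p, q, hpq⟩ := A.exists_square huv hab
    obtain ⟨u₂, x, hx⟩ := A.exists_square huf hae
    obtain ⟨v₂, y, hy⟩ := A.exists_square hvf hbe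
    obtain ⟨u₃, v₃, r, h1, h2⟩ := A.coherence _ _ _ _ _ _ _ _ _ hx hy hpq
    have hp := A.isPathFrom_append_of_square h1 (A.isPathFrom_append_of_square hx hu)
    refine ⟨A.cls ⟨_, hp⟩, A.cls_append_le_iff.2 ⟨[u₂, u₃], ?_⟩,
      A.cls_append_le_iff.2 ⟨[q, r], ?_⟩, A.cls_append_le_iff.2 ⟨[x, u₃], ?_⟩⟩
    · have : A.PathEquiv (w.1 ++ [u, u₂, u₃]) (w.1 ++ [u, u₂, u₃]) := .refl _
      simpa using this
    · have := A.append_pathEquiv w.1 (.trans _ _ _ ((pathEquiv_of_square h1 []).cons u)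
        (pathEquiv_of_square hpq [r]))
      simpa using this
    · simpa using A.append_pathEquiv w.1 (pathEquiv_of_square hx [u₃])

end WeakAsyncGraph

theorem mainTheorem10 :
    (∀ {N : Type u} {U : Type v} (A : WeakAsyncGraph N U), A.IsWeakPrime →
      WeakPrimeDom.IsWeakPrimeDomain (Order.Ideal A.PathClass)) ∧
    (∀ (D : Type w) [PartialOrder D], WeakPrimeDom.IsWeakPrimeDomain D →
      ∃ (N U : Type w) (A : WeakAsyncGraph N U), A.IsWeakPrime ∧
        Nonempty (D ≃o Order.Ideal A.PathClass)) := by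
  refine ⟨fun A _ => A.isFusionOrder_pathClass.isWeakPrimeDomain_ideal, fun D _ hD => ?_⟩
  have hP := hD.isFusionOrder
  obtain ⟨b, hb⟩ := hP.exists_bot
  obtain ⟨e⟩ := hP.nonempty_pathClass_orderIso hb
  exact ⟨_, _, hP.weakAsyncGraph b, hP.isWeakPrime_weakAsyncGraph b,
    hD.isDomainOrder.nonempty_orderIso_ideal e⟩
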